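/- Let $H_A$ be a densely defined symmetric operator on a complex Hilbert space $\mathcal H_A$ and let $H_B$ be a self-adjoint operator on a complex Hilbert space $\mathcal H_B$. Let $\mathcal H_A\hat\otimes\mathcal H_B$ be the Hilbert tensor product and let $$H_{AB}=H_A\otimes\mathbb I+\mathbb I\otimes H_B$$ be defined on the algebraic tensor product $\mathrm{Dom}(H_A)\otimes\mathrm{Dom}(H_B)$. For a densely defined symmetric operator $T$ write $\mathcal N_\pm(T)=\ker(T^\dagger\mp i\mathbb I)$ for its deficiency spaces, and put $\mathcal N_{A\pm}=\mathcal N_\pm(H_A)$, $\mathcal N_{AB\pm}=\mathcal N_\pm(H_{AB})$. For a unitary $K:\mathcal N_+(T)\to\mathcal N_-(T)$ let $T_K$ be the operator with $$\mathrm{Dom}(T_K)=\mathrm{Dom}(\overline T)+(\mathbb I+K)\mathcal N_+(T),\qquad T_K(\Phi_0+\xi+K\xi)=\overline T\,\Phi_0+i(\xi-K\xi).$$ Then $H_{AB}$ is densely defined and symmetric, and there are unitary isomorphisms $$\mathcal N_{AB+}\simeq\mathcal N_{A+}\hat\otimes\mathcal H_B,\qquad \mathcal N_{AB-}\simeq\mathcal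 N_{A-}\hat\otimes\mathcal H_B .$$ Moreover, let $J_\pm:\mathcal N_{AB\pm}\to\mathcal N_{A\pm}\hat\otimes\mathcal H_B$ be any such unitary isomorphisms. Then: 1. $W\mapsto (H_{AB})_{J_-^{-1}WJ_+}$ is a bijection from the set of unitary operators $W:\mathcal N_{A+}\hat\otimes\mathcal H_B\to\mathcal N_{A-}\hat\otimes\mathcal H_B$ onto the set of self-adjoint extensions of $H_{AB}$. 2. Call an extension decomposable (relative to $J_\pm$) if it comes from an operator $W=U\otimes V$ with $U:\mathcal N_{A+}\to\mathcal N_{A-}$ and $V:\mathcal H_B\to\mathcal H_B$ unitary. Every decomposable extension is a self-adjoint extension of $H_{AB}$. If $H_{AB}$ has at least one self-adjoint extension, $\dim\mathcal H_B\ge 2$, and at least one of $\dim\mathcal N_{A+}$, $\dim\mathcal N_{A-}$ is at least $2$, then the set of decomposable extensions is a proper subset of the set of self-adjoint extensions of $H_{AB}$. -/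

import Mathlib

open scoped TensorProduct

noncomputable section

namespace DeficiencyTensor

/-- The Hilbert tensor product: the completion of the algebraic tensor product with respect to the
inner product `⟪x ⊗ y, x' ⊗ y'⟫ = ⟪x, x'⟫ * ⟪y, y'⟫`. -/
abbrev HilbertTensor (E F : Type*) [NormedAddCommGroup E] [InnerProductSpace ℂ E]
    [NormedAddCommGroup F] [InnerProductSpace ℂ F] : Type _ :=
  UniformSpace.Completion (E ⊗[ℂ] F)

/-- The elementary tensor `x ⊗ y` in the Hilbert tensor product. -/
def htmul {E F : Type*} [NormedAddCommGroup E] [InnerProductSpace ℂ E]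
    [NormedAddCommGroup F] [InnerProductSpace ℂ F] (x : E) (y : F) : HilbertTensor E F :=
  ((x ⊗ₜ[ℂ] y : E ⊗[ℂ] F) : UniformSpace.Completion (E ⊗[ℂ] F))

/-- The inclusion of the algebraic tensor product of two subspaces into the Hilbert tensor product
of the ambient spaces. -/
def tensorIncl {E F : Type*} [NormedAddCommGroup E] [InnerProductSpace ℂ E]
    [NormedAddCommGroup F] [InnerProductSpace ℂ F] (D : Submodule ℂ E) (D' : Submodule ℂ F) :
    (D ⊗[ℂ] D') →ₗᵢ[ℂ] HilbertTensor E F :=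
  (UniformSpace.Completion.toComplₗᵢ (𝕜 := ℂ) (E := E ⊗[ℂ] F)).comp
    (TensorProduct.mapInclIsometry D D')

theorem tensorIncl_injective {E F : Type*} [NormedAddCommGroup E] [InnerProductSpace ℂ E]
    [NormedAddCommGroup F] [InnerProductSpace ℂ F] (D : Submodule ℂ E) (D' : Submodule ℂ F) :
    Function.Injective (tensorIncl D D').toLinearMap :=
  fun _ _ h => LinearIsometry.injective (tensorIncl D D') h

/-- The operator `A ⊗ I + I ⊗ B` on the Hilbert tensor product. Its domain is the algebraic tensor
product of the domains of `A` and `B`, on which it acts by `x ⊗ y ↦ A x ⊗ y + x ⊗ B y`. -/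
def tensorSum {E F : Type*} [NormedAddCommGroup E] [InnerProductSpace ℂ E]
    [NormedAddCommGroup F] [InnerProductSpace ℂ F] (A : E →ₗ.[ℂ] E) (B : F →ₗ.[ℂ] F) :
    HilbertTensor E F →ₗ.[ℂ] HilbertTensor E F where
  domain := LinearMap.range (tensorIncl A.domain B.domain).toLinearMap
  toFun :=
    (UniformSpace.Completion.toComplₗᵢ (𝕜 := ℂ) (E := E ⊗[ℂ] F)).toLinearMap ∘ₗ
      (TensorProduct.map A.toFun B.domain.subtype + TensorProduct.map A.domain.subtype B.toFun) ∘ₗ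
      (LinearEquiv.ofInjective (tensorIncl A.domain B.domain).toLinearMap
        (tensorIncl_injective A.domain B.domain)).symm.toLinearMap

theorem htmul_mem_tensorSum_domain {E F : Type*} [NormedAddCommGroup E] [InnerProductSpace ℂ E]
    [NormedAddCommGroup F] [InnerProductSpace ℂ F] (A : E →ₗ.[ℂ] E) (B : F →ₗ.[ℂ] F)
    (x : A.domain) (y : B.domain) : htmul (x : E) (y : F) ∈ (tensorSum A B).domain :=
  ⟨x ⊗ₜ y, rfl⟩

theorem tensorSum_htmul {E F : Type*} [NormedAddCommGroup E] [InnerProductSpace ℂ E]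
    [NormedAddCommGroup F] [InnerProductSpace ℂ F] (A : E →ₗ.[ℂ] E) (B : F →ₗ.[ℂ] F)
    (x : A.domain) (y : B.domain) :
    tensorSum A B ⟨htmul (x : E) (y : F), htmul_mem_tensorSum_domain A B x y⟩ =
      htmul (A x) (y : F) + htmul (x : E) (B y) := by
  have h : (LinearEquiv.ofInjective (tensorIncl A.domain B.domain).toLinearMap
      (tensorIncl_injective A.domain B.domain)).symm
      ⟨htmul (x : E) (y : F), htmul_mem_tensorSum_domain A B x y⟩ = x ⊗ₜ y := by
    rw [LinearEquiv.symm_apply_eq]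
    rfl
  change (UniformSpace.Completion.toComplₗᵢ (𝕜 := ℂ) (E := E ⊗[ℂ] F))
    ((TensorProduct.map A.toFun B.domain.subtype + TensorProduct.map A.domain.subtype B.toFun)
      ((LinearEquiv.ofInjective (tensorIncl A.domain B.domain).toLinearMap
        (tensorIncl_injective A.domain B.domain)).symm
        ⟨htmul (x : E) (y : F), htmul_mem_tensorSum_domain A B x y⟩)) = _
  rw [h, LinearMap.add_apply, map_add]
  rfl

/-- The kernel of `T† - z`. -/
def adjointEigenspace {E : Type*} [NormedAddCommGroup E] [InnerProductSpace ℂ E] [CompleteSpace E]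
    (T : E →ₗ.[ℂ] E) (z : ℂ) : Submodule ℂ E :=
  T.adjoint.graph.comap (LinearMap.id.prod (z • LinearMap.id))

theorem mem_adjointEigenspace {E : Type*} [NormedAddCommGroup E] [InnerProductSpace ℂ E]
    [CompleteSpace E] (T : E →ₗ.[ℂ] E) (z : ℂ) (x : E) :
    x ∈ adjointEigenspace T z ↔ ∃ h : x ∈ T.adjoint.domain, T.adjoint ⟨x, h⟩ = z • x := by
  simp [adjointEigenspace, LinearPMap.mem_graph_iff]

/-- The deficiency space `N₊ = ker (T† - i)`. -/
abbrev defectPlus {E : Type*} [NormedAddCommGroup E] [InnerProductSpace ℂ E] [CompleteSpace E]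
    (T : E →ₗ.[ℂ] E) : Submodule ℂ E :=
  adjointEigenspace T Complex.I

/-- The deficiency space `N₋ = ker (T† + i)`. -/
abbrev defectMinus {E : Type*} [NormedAddCommGroup E] [InnerProductSpace ℂ E] [CompleteSpace E]
    (T : E →ₗ.[ℂ] E) : Submodule ℂ E :=
  adjointEigenspace T (-Complex.I)

/-- The set of self-adjoint extensions of `T`. -/
def selfAdjointExtensions {E : Type*} [NormedAddCommGroup E] [InnerProductSpace ℂ E]
    [CompleteSpace E] (T : E →ₗ.[ℂ] E) : Set (E →ₗ.[ℂ] E) :=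
  {S | IsSelfAdjoint S ∧ T ≤ S}

/-- The von Neumann extension `T_K` defined by a unitary `K : N₊ → N₋`: the restriction of `T†` to
`Dom (closure of T) + (I + K) N₊`. For `T` symmetric and densely defined it maps
`Φ₀ + ξ + K ξ` to `(closure of T) Φ₀ + i (ξ - K ξ)`. -/
def vonNeumannExtension {E : Type*} [NormedAddCommGroup E] [InnerProductSpace ℂ E]
    [CompleteSpace E] (T : E →ₗ.[ℂ] E) (K : defectPlus T ≃ₗᵢ[ℂ] defectMinus T) : E →ₗ.[ℂ] E :=
  T.adjoint.domRestrict (T.closure.domain ⊔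
    LinearMap.range ((defectPlus T).subtype +
      (defectMinus T).subtype ∘ₗ K.toLinearEquiv.toLinearMap))

theorem closure_le_adjoint {E : Type*} [NormedAddCommGroup E] [InnerProductSpace ℂ E]
    [CompleteSpace E] (T : E →ₗ.[ℂ] E) (hd : Dense (T.domain : Set E))
    (hs : T.IsFormalAdjoint T) : T.closure ≤ T.adjoint := by
  have hcl : T.adjoint.IsClosed := LinearPMap.adjoint_isClosed hd
  have hT : T.IsClosable := hcl.isClosable.leIsClosable (hs.le_adjoint hd)
  refine LinearPMap.le_of_le_graph ?_
  rw [← hT.graph_closure_eq_closure_graph]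
  exact Submodule.topologicalClosure_minimal _ (LinearPMap.le_graph_of_le (hs.le_adjoint hd)) hcl

/-- For `T` symmetric and densely defined, `T_K` maps `Φ₀ + ξ + K ξ` to
`(closure of T) Φ₀ + i (ξ - K ξ)`. -/
theorem vonNeumannExtension_graph {E : Type*} [NormedAddCommGroup E] [InnerProductSpace ℂ E]
    [CompleteSpace E] (T : E →ₗ.[ℂ] E) (hd : Dense (T.domain : Set E))
    (hs : T.IsFormalAdjoint T) (K : defectPlus T ≃ₗᵢ[ℂ] defectMinus T) (x y : E) :
    (x, y) ∈ (vonNeumannExtension T K).graph ↔ ∃ (p : T.closure.domain) (ξ : defectPlus T),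
      x = p + (ξ + K ξ) ∧ y = T.closure p + Complex.I • ((ξ : E) - K ξ) := by
  have hle := closure_le_adjoint T hd hs
  have key : ∀ (p : T.closure.domain) (ξ : defectPlus T),
      ((p : E) + (ξ + K ξ), T.closure p + Complex.I • ((ξ : E) - K ξ)) ∈ T.adjoint.graph := by
    intro p ξ
    have h1 : ((p : E), T.closure p) ∈ T.adjoint.graph :=
      LinearPMap.le_graph_of_le hle (T.closure.mem_graph p)
    have h2 : ((ξ : E), Complex.I • (ξ : E)) ∈ T.adjoint.graph := ξ.2
    have h3 : ((K ξ : E), (-Complex.I) • (K ξ : E)) ∈ T.adjoint.graph := (K ξ).2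
    have h4 := T.adjoint.graph.add_mem h1 (T.adjoint.graph.add_mem h2 h3)
    have h5 : (p : E) + (ξ + K ξ) = (p : E) + ((ξ : E) + (K ξ : E)) := rfl
    simpa [smul_sub, sub_eq_add_neg] using h4
  constructor
  · intro h
    obtain ⟨z, hz1, hz2⟩ := (LinearPMap.mem_graph_iff _).1 h
    have hz := z.2
    obtain ⟨p, hp, q, ⟨ξ, hξ⟩, hpq⟩ := Submodule.mem_sup.1 hz.1
    have hx : x = p + (ξ + K ξ) := by
      rw [← show (z : E) = x from hz1, ← hpq, ← hξ]
      rfl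
    refine ⟨⟨p, hp⟩, ξ, hx, ?_⟩
    have h1 : (x, y) ∈ T.adjoint.graph :=
      LinearPMap.le_graph_of_le LinearPMap.domRestrict_le h
    have h2 := key ⟨p, hp⟩ ξ
    exact LinearPMap.mem_graph_snd_inj _ h1 h2 hx
  · rintro ⟨p, ξ, rfl, rfl⟩
    obtain ⟨z, hz1, hz2⟩ := (LinearPMap.mem_graph_iff _).1 (key p ξ)
    refine (LinearPMap.mem_graph_iff _).2 ⟨⟨(p : E) + (ξ + K ξ), ?_, ?_⟩, rfl, ?_⟩
    · exact Submodule.add_mem_sup p.2 ⟨ξ, rfl⟩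
    · have := z.2
      rwa [hz1] at this
    · rw [← hz2]
      exact LinearPMap.domRestrict_apply hz1.symm

/-- A unitary `W : M ⊗ F → N ⊗ F` is decomposable if `W = U ⊗ V` for unitaries `U : M → N` and
`V : F → F`. -/
def IsDecomposable {M N F : Type*} [NormedAddCommGroup M] [InnerProductSpace ℂ M]
    [NormedAddCommGroup N] [InnerProductSpace ℂ N] [NormedAddCommGroup F] [InnerProductSpace ℂ F]
    (W : HilbertTensor M F ≃ₗᵢ[ℂ] HilbertTensor N F) : Prop :=
  ∃ (U : M ≃ₗᵢ[ℂ] N) (V : F ≃ₗᵢ[ℂ] F), ∀ (x : M) (y : F), W (htmul x y) = htmul (U x) (V y)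

/-- The extension of `A ⊗ I + I ⊗ B` that belongs to a unitary
`W : N_{A+} ⊗ F → N_{A-} ⊗ F`, through identifications `J₊`, `J₋` of the deficiency spaces
`N_{AB±}` with `N_{A±} ⊗ F`: the von Neumann extension of `J₋⁻¹ ∘ W ∘ J₊`. -/
def extensionOf {E F : Type*} [NormedAddCommGroup E] [InnerProductSpace ℂ E] [CompleteSpace E]
    [NormedAddCommGroup F] [InnerProductSpace ℂ F] (A : E →ₗ.[ℂ] E) (B : F →ₗ.[ℂ] F)
    (Jp : defectPlus (tensorSum A B) ≃ₗᵢ[ℂ] HilbertTensor (defectPlus A) F)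
    (Jm : defectMinus (tensorSum A B) ≃ₗᵢ[ℂ] HilbertTensor (defectMinus A) F)
    (W : HilbertTensor (defectPlus A) F ≃ₗᵢ[ℂ] HilbertTensor (defectMinus A) F) :
    HilbertTensor E F →ₗ.[ℂ] HilbertTensor E F :=
  vonNeumannExtension (tensorSum A B) ((Jp.trans W).trans Jm.symm)

/-- The decomposable extensions of `A ⊗ I + I ⊗ B`, relative to identifications `J₊`, `J₋`. -/
def decomposableExtensions {E F : Type*} [NormedAddCommGroup E] [InnerProductSpace ℂ E]
    [CompleteSpace E] [NormedAddCommGroup F] [InnerProductSpace ℂ F] (A : E →ₗ.[ℂ] E)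
    (B : F →ₗ.[ℂ] F)
    (Jp : defectPlus (tensorSum A B) ≃ₗᵢ[ℂ] HilbertTensor (defectPlus A) F)
    (Jm : defectMinus (tensorSum A B) ≃ₗᵢ[ℂ] HilbertTensor (defectMinus A) F) :
    Set (HilbertTensor E F →ₗ.[ℂ] HilbertTensor E F) :=
  extensionOf A B Jp Jm '' {W | IsDecomposable W}

end DeficiencyTensor

end

open DeficiencyTensor

/-! Write `c` for `i` or `-i`. The space `ker (T† - c)` is the orthogonal complement of the range of
`T + c`, so the deficiency spaces of the sum are governed by the identity `2c (A ⊗ I + I ⊗ B + c) =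
(A + c) ⊗ (B + 2c) - (A - c) ⊗ B`. Let `V` be a contraction extending the Cayley transform `(A + c)
x ↦ (A - c) x`, and let `G = B (B - 2c)⁻¹`, whose adjoint is `B (B + 2c)⁻¹`. Since `B + 2c` is onto,
the identity says that `ξ` lies in the deficiency space of the sum exactly when `D ξ = ξ - (V† ⊗ G)
ξ` is orthogonal to `ran (A + c) ⊗ F`, that is, when `D ξ` lies in `N ⊗ F` with `N = ker (A† - c)`.
With `R = (B - 2c)⁻¹` one has `‖G y‖² + 4 ‖R y‖² = ‖y‖²`. Hence `D` is injective
(`eq_zero_of_tmap_eq_self`), and its Neumann series converges on `x ⊗ R³ y` (`exists_sub_tmap_eq`).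
So `D` maps the deficiency space injectively onto a dense part of `N ⊗ F`, and polar decomposition
turns it into a unitary. Claim 1 is then von Neumann's theorem (`bijOn_vonNeumannExtension`) carried
through `J₊` and `J₋`. For claim 2, a reflection with respect to one elementary tensor is not of the
form `U ⊗ V`, and composing it with a decomposable unitary gives a non-decomposable one. -/

noncomputable section

namespace DeficiencyTensor

local notation "⟪" x ", " y "⟫" => inner ℂ x y

/-! ### Symmetric and self-adjoint operators shifted by an imaginary number -/

section Unbounded

variable {E : Type*} [NormedAddCommGroup E] [InnerProductSpace ℂ E]

/-- For a symmetric operator `S` and an imaginary number `c`, the graph norm controls `S + c`. -/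
theorem norm_add_smul_sq_of_symm {S : E →ₗ.[ℂ] E} (hs : S.IsFormalAdjoint S) {c : ℂ}
    (hc : star c = -c) (p : S.domain) :
    ‖S p + c • (p : E)‖ ^ 2 = ‖S p‖ ^ 2 + ‖c‖ ^ 2 * ‖(p : E)‖ ^ 2 := by
  have h0 : (⟪S p, c • (p : E)⟫).re = 0 := by
    have h1 : star ⟪S p, c • (p : E)⟫ = - ⟪S p, c • (p : E)⟫ := by
      rw [inner_smul_right, star_mul', hc, ← starRingEnd_apply, inner_conj_symm, hs p p]
      ring
    have h2 := congrArg Complex.re h1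
    simp only [Complex.star_def, Complex.conj_re, Complex.neg_re] at h2
    linarith
  rw [@norm_add_sq ℂ, norm_smul, mul_pow]
  simp [h0]

theorem norm_add_smul_eq_norm_sub_smul {S : E →ₗ.[ℂ] E} (hs : S.IsFormalAdjoint S) {c : ℂ}
    (hc : star c = -c) (p : S.domain) : ‖S p + c • (p : E)‖ = ‖S p - c • (p : E)‖ := by
  have h1 := norm_add_smul_sq_of_symm hs hc p
  have h2 := norm_add_smul_sq_of_symm hs (c := -c) (by simp [hc]) p
  rw [neg_smul, ← sub_eq_add_neg, norm_neg, ← h1] at h2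
  exact ((sq_eq_sq₀ (norm_nonneg _) (norm_nonneg _)).1 h2).symm

/-- The linear map `S + c` on the domain of `S`. -/
def shift (S : E →ₗ.[ℂ] E) (c : ℂ) : S.domain →ₗ[ℂ] E := S.toFun + c • S.domain.subtype

theorem shift_apply (S : E →ₗ.[ℂ] E) (c : ℂ) (p : S.domain) : shift S c p = S p + c • (p : E) :=
  rfl

theorem norm_le_norm_shift {S : E →ₗ.[ℂ] E} (hs : S.IsFormalAdjoint S) {c : ℂ}
    (hc : star c = -c) (p : S.domain) : ‖c‖ * ‖(p : E)‖ ≤ ‖shift S c p‖ := by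
  have h1 := norm_add_smul_sq_of_symm hs hc p
  rw [shift_apply]
  refine le_of_sq_le_sq ?_ (norm_nonneg _)
  rw [h1, mul_pow]
  nlinarith [sq_nonneg ‖S p‖]

theorem norm_apply_le_norm_shift {S : E →ₗ.[ℂ] E} (hs : S.IsFormalAdjoint S) {c : ℂ}
    (hc : star c = -c) (p : S.domain) : ‖S p‖ ≤ ‖shift S c p‖ := by
  have h1 := norm_add_smul_sq_of_symm hs hc p
  rw [shift_apply]
  refine le_of_sq_le_sq ?_ (norm_nonneg _)
  rw [h1]
  nlinarith [mul_nonneg (sq_nonneg ‖c‖) (sq_nonneg ‖(p : E)‖)]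

variable [CompleteSpace E]

/-- The graph is complete, and `(x, S x) ↦ S x + c x` is bounded below on it by the norm identity,
so its image is closed. -/
theorem isClosed_range_shift {S : E →ₗ.[ℂ] E} (hs : S.IsFormalAdjoint S) (hcl : S.IsClosed) {c : ℂ}
    (hc : star c = -c) (hc0 : c ≠ 0) : IsClosed (LinearMap.range (shift S c) : Set E) := by
  have : CompleteSpace S.graph := IsComplete.completeSpace_coe (_root_.IsClosed.isComplete hcl)
  let e : S.graph →L[ℂ] E := (ContinuousLinearMap.snd ℂ E E +
    c • ContinuousLinearMap.fst ℂ E E).comp S.graph.subtypeL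
  have he : ∀ g : S.graph, ∃ p : S.domain, (g : E × E) = (↑p, S p) ∧ e g = shift S c p := by
    rintro ⟨⟨x, y⟩, hg⟩
    obtain ⟨p, rfl, rfl⟩ := (LinearPMap.mem_graph_iff _).1 hg
    exact ⟨p, rfl, rfl⟩
  have hanti : AntilipschitzWith (1 + ‖c‖₊⁻¹) e := by
    refine ContinuousLinearMap.antilipschitz_of_bound e fun g => ?_
    obtain ⟨p, hg, hp⟩ := he g
    have hc' : 0 < ‖c‖ := norm_pos_iff.2 hc0
    rw [hp, ← Submodule.norm_coe, hg, Prod.norm_def]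
    have h1 := norm_le_norm_shift hs hc p
    have h2 := norm_apply_le_norm_shift hs hc p
    have h3 : ‖(p : E)‖ ≤ ‖c‖⁻¹ * ‖shift S c p‖ := by
      rw [inv_mul_eq_div, le_div_iff₀ hc']; linarith
    have h4 : 0 ≤ ‖c‖⁻¹ * ‖shift S c p‖ := by positivity
    push_cast
    refine max_le ?_ ?_ <;> simp only [add_mul, one_mul] <;> linarith [norm_nonneg (shift S c p)]
  have h := hanti.isClosed_range e.uniformContinuous
  convert h using 1
  ext u
  constructor
  · rintro ⟨p, rfl⟩
    exact ⟨⟨(p, S p), S.mem_graph p⟩, rfl⟩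
  · rintro ⟨g, rfl⟩
    obtain ⟨p, -, hp⟩ := he g
    exact ⟨p, hp.symm⟩

theorem exists_eq_shift_add {S : E →ₗ.[ℂ] E} (hs : S.IsFormalAdjoint S) (hcl : S.IsClosed) {c : ℂ}
    (hc : star c = -c) (hc0 : c ≠ 0) (u : E) :
    ∃ (p : S.domain) (n : E), u = shift S c p + n ∧ ∀ q, ⟪shift S c q, n⟫ = 0 := by
  have hcl := isClosed_range_shift hs hcl hc hc0
  have : CompleteSpace (LinearMap.range (shift S c)) := hcl.completeSpace_coe
  obtain ⟨y, ⟨p, rfl⟩, n, hn, h⟩ :=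
    Submodule.exists_add_mem_mem_orthogonal (K := LinearMap.range (shift S c)) u
  exact ⟨p, n, h, fun q => (Submodule.mem_orthogonal _ _).1 hn _ ⟨q, rfl⟩⟩

theorem mem_adjoint_graph_iff {T : E →ₗ.[ℂ] E} (hd : Dense (T.domain : Set E)) (x y : E) :
    (x, y) ∈ T.adjoint.graph ↔ ∀ p : T.domain, ⟪T p, x⟫ = ⟪(p : E), y⟫ := by
  simp only [LinearPMap.adjoint_graph_eq_graph_adjoint hd, Submodule.mem_adjoint_iff,
    LinearPMap.mem_graph_iff, sub_eq_zero]
  constructor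
  · intro h p
    exact h _ _ ⟨p, rfl, rfl⟩
  · rintro h _ _ ⟨p, rfl, rfl⟩
    exact h p

/-- For imaginary `c` the kernel of `T† - c` is the orthogonal complement of the range of
`T + c`. -/
theorem mem_adjointEigenspace_iff {T : E →ₗ.[ℂ] E} (hd : Dense (T.domain : Set E)) {c : ℂ}
    (hc : star c = -c) (x : E) :
    x ∈ adjointEigenspace T c ↔ ∀ p, ⟪shift T c p, x⟫ = 0 := by
  change (x, c • x) ∈ T.adjoint.graph ↔ _
  rw [mem_adjoint_graph_iff hd]
  refine forall_congr' fun p => ?_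
  rw [shift_apply, inner_add_left, inner_smul_left, inner_smul_right, starRingEnd_apply, hc,
    neg_mul, ← sub_eq_add_neg, sub_eq_zero]

/-- A symmetric densely defined operator such that `S + c` and `S - c` are onto is self-adjoint. -/
theorem isSelfAdjoint_of_surjective_shift {S : E →ₗ.[ℂ] E} (hd : Dense (S.domain : Set E))
    (hs : S.IsFormalAdjoint S) {c : ℂ} (hc : star c = -c)
    (h1 : Function.Surjective (shift S c)) (h2 : Function.Surjective (shift S (-c))) :
    IsSelfAdjoint S := by
  refine le_antisymm ?_ (hs.le_adjoint hd)
  refine LinearPMap.le_of_le_graph ?_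
  rintro ⟨x, y⟩ hxy
  replace hxy : (x, y) ∈ S.adjoint.graph := hxy
  -- Choosing `p` with `S p + c p = y + c x` puts `x - p` in `ker (S† + c)`, which is orthogonal to
  -- the range of `S - c`, hence zero.
  obtain ⟨p, hp⟩ := h1 (y + c • x)
  have hpg : ((p : E), S p) ∈ S.adjoint.graph :=
    LinearPMap.le_graph_of_le (hs.le_adjoint hd) (S.mem_graph p)
  have hsub : (x - p, (-c) • (x - p)) ∈ S.adjoint.graph := by
    have := S.adjoint.graph.sub_mem hxy hpg
    have e : y - S p = (-c) • (x - p) := by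
      rw [shift_apply] at hp
      rw [eq_sub_of_add_eq hp, smul_sub, neg_smul, neg_smul]
      abel
    simpa only [Prod.mk_sub_mk, e] using this
  have hker := (mem_adjointEigenspace_iff hd (c := -c) (by simp [hc]) (x - p)).1 hsub
  obtain ⟨q, hq⟩ := h2 (x - p)
  have hxp : x - p = 0 := by
    have := hker q
    rwa [hq, inner_self_eq_zero] at this
  have hx : x = p := sub_eq_zero.1 hxp
  have hy : y = S p := LinearPMap.mem_graph_snd_inj _ hxy hpg hx
  rw [hx, hy]
  exact S.mem_graph p

theorem isFormalAdjoint_of_isSelfAdjoint {S : E →ₗ.[ℂ] E} (h : IsSelfAdjoint S) :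
    S.IsFormalAdjoint S := by
  have := LinearPMap.adjoint_isFormalAdjoint h.dense_domain
  rwa [LinearPMap.isSelfAdjoint_def.1 h] at this

theorem surjective_shift_of_isSelfAdjoint {S : E →ₗ.[ℂ] E} (h : IsSelfAdjoint S) {c : ℂ}
    (hc : star c = -c) (hc0 : c ≠ 0) : Function.Surjective (shift S c) := by
  intro u
  have hs := isFormalAdjoint_of_isSelfAdjoint h
  obtain ⟨p, n, rfl, hn⟩ := exists_eq_shift_add hs h.isClosed hc hc0 u
  have hn' := (mem_adjointEigenspace_iff h.dense_domain hc n).2 hn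
  replace hn' : (n, c • n) ∈ S.adjoint.graph := hn'
  rw [LinearPMap.isSelfAdjoint_def.1 h] at hn'
  obtain ⟨q, hq, hq2⟩ := (LinearPMap.mem_graph_iff _).1 hn'
  have h1 := norm_le_norm_shift hs (c := -c) (by simp [hc]) q
  have h2 : shift S (-c) q = 0 := by
    rw [shift_apply, hq2, hq]
    simp
  rw [h2, norm_zero, norm_neg, hq] at h1
  have h3 : n = 0 := by
    rw [← norm_le_zero_iff]
    exact nonpos_of_mul_nonpos_right h1 (norm_pos_iff.2 hc0)
  exact ⟨p, by rw [h3, add_zero]⟩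

/-- The resolvent of a self-adjoint operator at an imaginary number. -/
theorem exists_resolvent {S : E →ₗ.[ℂ] E} (h : IsSelfAdjoint S) {c : ℂ}
    (hc : star c = -c) (hc0 : c ≠ 0) :
    ∃ R : E →L[ℂ] E, ∀ f, ∃ p : S.domain, R f = p ∧ shift S c p = f := by
  have hs := isFormalAdjoint_of_isSelfAdjoint h
  have hinj : Function.Injective (shift S c) := by
    rw [injective_iff_map_eq_zero]
    intro p hp
    have h1 := norm_le_norm_shift hs hc p
    rw [hp, norm_zero] at h1
    have := nonpos_of_mul_nonpos_right h1 (norm_pos_iff.2 hc0)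
    exact_mod_cast norm_le_zero_iff.1 this
  let e := LinearEquiv.ofBijective (shift S c) ⟨hinj, surjective_shift_of_isSelfAdjoint h hc hc0⟩
  refine ⟨(S.domain.subtype ∘ₗ e.symm.toLinearMap).mkContinuous ‖c‖⁻¹ fun f => ?_,
    fun f => ⟨e.symm f, rfl, e.apply_symm_apply f⟩⟩
  have h1 := norm_le_norm_shift hs hc (e.symm f)
  rw [show shift S c (e.symm f) = f from e.apply_symm_apply f] at h1
  rw [inv_mul_eq_div, le_div_iff₀ (norm_pos_iff.2 hc0), mul_comm]
  exact h1

end Unbounded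

/-! ### Von Neumann's parametrization of self-adjoint extensions -/

section VonNeumann

variable {E : Type*} [NormedAddCommGroup E] [InnerProductSpace ℂ E] [CompleteSpace E]

theorem star_I : star Complex.I = -Complex.I := Complex.conj_I

theorem star_neg_I : star (-Complex.I) = -(-Complex.I) := by rw [star_neg, star_I]

theorem inner_closure_eq {T : E →ₗ.[ℂ] E} (hd : Dense (T.domain : Set E))
    (hs : T.IsFormalAdjoint T) (p : T.closure.domain) {x y : E} (h : (x, y) ∈ T.adjoint.graph) :
    ⟪T.closure p, x⟫ = ⟪(p : E), y⟫ := by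
  have hT : T.IsClosable := (LinearPMap.adjoint_isClosed hd).isClosable.leIsClosable
    (hs.le_adjoint hd)
  have hp : ((p : E), T.closure p) ∈ closure (T.graph : Set (E × E)) := by
    have := T.closure.mem_graph p
    rwa [← hT.graph_closure_eq_closure_graph] at this
  have hcl : IsClosed {z : E × E | ⟪z.2, x⟫ = ⟪z.1, y⟫} :=
    isClosed_eq (by fun_prop) (by fun_prop)
  refine closure_minimal ?_ hcl hp
  rintro ⟨a, b⟩ hab
  obtain ⟨q, rfl, rfl⟩ := (LinearPMap.mem_graph_iff _).1 hab
  exact (mem_adjoint_graph_iff hd x y).1 h q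

theorem isFormalAdjoint_closure {T : E →ₗ.[ℂ] E} (hd : Dense (T.domain : Set E))
    (hs : T.IsFormalAdjoint T) : T.closure.IsFormalAdjoint T.closure := fun p q =>
  inner_closure_eq hd hs p
    (LinearPMap.le_graph_of_le (closure_le_adjoint T hd hs) (T.closure.mem_graph q))

theorem isClosed_closure {T : E →ₗ.[ℂ] E} (hd : Dense (T.domain : Set E))
    (hs : T.IsFormalAdjoint T) : T.closure.IsClosed :=
  ((LinearPMap.adjoint_isClosed hd).isClosable.leIsClosable (hs.le_adjoint hd)).closure_isClosed

theorem inner_shift_closure_eq_zero {T : E →ₗ.[ℂ] E} (hd : Dense (T.domain : Set E))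
    (hs : T.IsFormalAdjoint T) {c : ℂ} (hc : star c = -c) (p : T.closure.domain)
    (n : adjointEigenspace T c) : ⟪shift T.closure c p, (n : E)⟫ = 0 := by
  rw [shift_apply, inner_add_left, inner_closure_eq hd hs p (x := n) (y := c • (n : E)) n.2,
    inner_smul_left, inner_smul_right, starRingEnd_apply, hc]
  ring

theorem exists_eq_shift_closure_add {T : E →ₗ.[ℂ] E} (hd : Dense (T.domain : Set E))
    (hs : T.IsFormalAdjoint T) {c : ℂ} (hc : star c = -c) (hc0 : c ≠ 0) (u : E) :
    ∃ (p : T.closure.domain) (n : adjointEigenspace T c), u = shift T.closure c p + n := by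
  obtain ⟨p, n, h, hn⟩ := exists_eq_shift_add (isFormalAdjoint_closure hd hs)
    (isClosed_closure hd hs) hc hc0 u
  refine ⟨p, ⟨n, (mem_adjointEigenspace_iff hd hc n).2 fun q => ?_⟩, h⟩
  have hq := T.le_closure
  have := hn ⟨q, hq.1 q.2⟩
  rwa [shift_apply, ← hq.2 (x := q) (y := ⟨q, hq.1 q.2⟩) rfl] at this

omit [CompleteSpace E] in
theorem isFormalAdjoint_of_graph {S : E →ₗ.[ℂ] E}
    (h : ∀ x y x' y', (x, y) ∈ S.graph → (x', y') ∈ S.graph → ⟪y, x'⟫ = ⟪x, y'⟫) :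
    S.IsFormalAdjoint S :=
  fun p q => h _ _ _ _ (S.mem_graph p) (S.mem_graph q)

section Extension

variable {T : E →ₗ.[ℂ] E} (hd : Dense (T.domain : Set E)) (hs : T.IsFormalAdjoint T)
  (K : defectPlus T ≃ₗᵢ[ℂ] defectMinus T)

theorem add_apply_mem_graph_adjoint (ξ : defectPlus T) :
    ((ξ : E) + K ξ, Complex.I • ((ξ : E) - K ξ)) ∈ T.adjoint.graph := by
  have h2 : ((ξ : E), Complex.I • (ξ : E)) ∈ T.adjoint.graph := ξ.2
  have h3 : ((K ξ : E), (-Complex.I) • (K ξ : E)) ∈ T.adjoint.graph := (K ξ).2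
  simpa [smul_sub, sub_eq_add_neg] using T.adjoint.graph.add_mem h2 h3

include hd hs

theorem vonNeumannExtension_isFormalAdjoint :
    (vonNeumannExtension T K).IsFormalAdjoint (vonNeumannExtension T K) := by
  refine isFormalAdjoint_of_graph fun x y x' y' h h' => ?_
  obtain ⟨p, ξ, rfl, rfl⟩ := (vonNeumannExtension_graph T hd hs K x y).1 h
  obtain ⟨q, η, rfl, rfl⟩ := (vonNeumannExtension_graph T hd hs K x' y').1 h'
  have h1 := isFormalAdjoint_closure hd hs p q
  have h2 := inner_closure_eq hd hs p (add_apply_mem_graph_adjoint K η)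
  have h3 := inner_closure_eq hd hs q (add_apply_mem_graph_adjoint K ξ)
  replace h3 := congrArg (starRingEnd ℂ) h3
  rw [inner_conj_symm, inner_conj_symm] at h3
  have h4 : ⟪(K ξ : E), (K η : E)⟫ = ⟪(ξ : E), (η : E)⟫ := K.inner_map_map ξ η
  have h5 : ⟪Complex.I • ((ξ : E) - K ξ), (η : E) + K η⟫ =
      ⟪(ξ : E) + K ξ, Complex.I • ((η : E) - K η)⟫ := by
    simp only [inner_smul_left, inner_smul_right, inner_add_left, inner_add_right, inner_sub_left,
      inner_sub_right, h4, Complex.conj_I]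
    ring
  have key : ∀ a b c d a' b' c' d' : E, ⟪c, a'⟫ = ⟪a, c'⟫ → ⟪c, b'⟫ = ⟪a, d'⟫ →
      ⟪b, c'⟫ = ⟪d, a'⟫ → ⟪d, b'⟫ = ⟪b, d'⟫ → ⟪c + d, a' + b'⟫ = ⟪a + b, c' + d'⟫ := by
    intro a b c d a' b' c' d' h1 h2 h3 h4
    simp only [inner_add_left, inner_add_right, h1, h2, h3, h4]
  exact key _ _ _ _ _ _ _ _ h1 h2 h3 h5

theorem le_vonNeumannExtension : T ≤ vonNeumannExtension T K := by
  refine LinearPMap.le_of_le_graph fun ⟨x, y⟩ h => ?_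
  have h1 := LinearPMap.le_graph_of_le T.le_closure h
  obtain ⟨p, hp, hp2⟩ := (LinearPMap.mem_graph_iff _).1 h1
  refine (vonNeumannExtension_graph T hd hs K x y).2 ⟨p, 0, ?_, ?_⟩
  · simpa using hp.symm
  · simpa using hp2.symm

/-- The space splits as `ran (closure of T ± i)` plus `N±`. On `ξ + K ξ` the operator `T_K + i`
gives `2i ξ` and `T_K - i` gives `-2i K ξ`, so the missing summand is also reached and both shifts
are onto. -/
theorem isSelfAdjoint_vonNeumannExtension : IsSelfAdjoint (vonNeumannExtension T K) := by
  have hsurj : ∀ {c : ℂ} (x y u : E), (x, y) ∈ (vonNeumannExtension T K).graph → u = y + c • x →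
      ∃ p, shift (vonNeumannExtension T K) c p = u := by
    rintro c x y u hxy rfl
    obtain ⟨p, rfl, rfl⟩ := (LinearPMap.mem_graph_iff _).1 hxy
    exact ⟨p, rfl⟩
  have hI : (2 * Complex.I) ≠ 0 := by simp
  refine isSelfAdjoint_of_surjective_shift (c := Complex.I)
    (hd.mono (le_vonNeumannExtension hd hs K).1) (vonNeumannExtension_isFormalAdjoint hd hs K)
    star_I ?_ ?_
  · intro u
    obtain ⟨p, n, rfl⟩ := exists_eq_shift_closure_add hd hs star_I Complex.I_ne_zero u
    refine hsurj _ _ _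
      ((vonNeumannExtension_graph T hd hs K _ _).2 ⟨p, (2 * Complex.I)⁻¹ • n, rfl, rfl⟩) ?_
    have hn : (n : E) = (2 * Complex.I) • (((2 * Complex.I)⁻¹ • n : defectPlus T) : E) := by
      rw [Submodule.coe_smul, smul_inv_smul₀ hI]
    rw [shift_apply]
    nth_rw 1 [hn]
    module
  · intro u
    obtain ⟨p, n, rfl⟩ := exists_eq_shift_closure_add hd hs star_neg_I
      (neg_ne_zero.2 Complex.I_ne_zero) u
    refine hsurj _ _ _ ((vonNeumannExtension_graph T hd hs K _ _).2
      ⟨p, K.symm (-(2 * Complex.I)⁻¹ • n), rfl, rfl⟩) ?_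
    have hn : (n : E) = -(2 * Complex.I) • ((-(2 * Complex.I)⁻¹ • n : defectMinus T) : E) := by
      rw [Submodule.coe_smul, neg_smul, neg_smul, smul_neg, neg_neg, smul_inv_smul₀ hI]
    rw [shift_apply, K.apply_symm_apply]
    nth_rw 1 [hn]
    module

omit K

theorem vonNeumannExtension_injective : Function.Injective (vonNeumannExtension T) := by
  intro K L h
  ext ξ
  have h1 : ((ξ : E) + K ξ, Complex.I • ((ξ : E) - K ξ)) ∈ (vonNeumannExtension T K).graph :=
    (vonNeumannExtension_graph T hd hs K _ _).2 ⟨0, ξ, by simp, by simp⟩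
  rw [h] at h1
  obtain ⟨p, η, hx, hy⟩ := (vonNeumannExtension_graph T hd hs L _ _).1 h1
  -- This vector lies both in `ran (closure of T + i)` and in its orthogonal complement `N₊`, so it
  -- vanishes; then `ξ = η` and `p = 0`.
  have hp : shift T.closure Complex.I p = ((2 * Complex.I) • (ξ - η) : defectPlus T) := by
    have h2 : (2 * Complex.I) • (ξ : E) =
        Complex.I • ((ξ : E) - K ξ) + Complex.I • ((ξ : E) + K ξ) := by module
    rw [shift_apply, Submodule.coe_smul, AddSubgroupClass.coe_sub, smul_sub, h2, hx, hy]
    module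
  have h3 := inner_shift_closure_eq_zero hd hs star_I p ((2 * Complex.I) • (ξ - η))
  rw [hp, inner_self_eq_zero] at h3
  have h4 : ξ = η := by
    have : (2 * Complex.I) • (ξ - η) = 0 := by exact_mod_cast h3
    rcases smul_eq_zero.1 this with h5 | h5
    · simp at h5
    · exact sub_eq_zero.1 h5
  have h6 := norm_le_norm_shift (isFormalAdjoint_closure hd hs) star_I p
  rw [hp, h3, norm_zero, Complex.norm_I, one_mul] at h6
  have h7 := norm_le_zero_iff.1 h6
  rw [h7, zero_add, ← h4] at hx
  exact add_left_cancel hx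

/-- Every self-adjoint extension is a von Neumann extension. -/
theorem exists_vonNeumannExtension_eq {S : E →ₗ.[ℂ] E} (hS : IsSelfAdjoint S) (hTS : T ≤ S) :
    ∃ K, vonNeumannExtension T K = S := by
  have hSs := isFormalAdjoint_of_isSelfAdjoint hS
  have hST : S ≤ T.adjoint := by
    refine LinearPMap.le_of_le_graph fun ⟨x, y⟩ h => ?_
    refine (mem_adjoint_graph_iff hd x y).2 fun p => ?_
    obtain ⟨q, rfl, rfl⟩ := (LinearPMap.mem_graph_iff _).1 h
    rw [hTS.2 (x := p) (y := ⟨p, hTS.1 p.2⟩) rfl]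
    exact hSs _ q
  have hI : (2 * Complex.I) ≠ 0 := by simp
  obtain ⟨R, hR⟩ := exists_resolvent hS star_I Complex.I_ne_zero
  have hRes : ∀ ξ : E, ∃ p : S.domain, (p : E) = (2 * Complex.I) • R ξ ∧
      S p + Complex.I • (p : E) = (2 * Complex.I) • ξ := by
    intro ξ
    obtain ⟨p, h1, h2⟩ := hR ξ
    refine ⟨(2 * Complex.I) • p, by rw [h1]; rfl, ?_⟩
    rw [← h2, ← shift_apply, map_smul]
  have hSp : ∀ {p : S.domain} {ξ : E}, S p + Complex.I • (p : E) = (2 * Complex.I) • ξ →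
      S p - Complex.I • (p : E) = -(2 * Complex.I) • ((p : E) - ξ) := by
    intro p ξ h
    rw [eq_sub_of_add_eq h]
    module
  -- This is minus the Cayley transform of `S`, with `R = (S + i)⁻¹`. The choice makes `ξ + K₀ ξ =
  -- 2i R ξ` an element of the domain of `S`.
  let K₀ : E →ₗ[ℂ] E := (2 * Complex.I) • R.toLinearMap - LinearMap.id
  have hK₀ : ∀ ξ, K₀ ξ = (2 * Complex.I) • R ξ - ξ := fun ξ => rfl
  have hmem : ∀ ξ ∈ defectPlus T, K₀ ξ ∈ defectMinus T := by
    intro ξ hξ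
    obtain ⟨p, h1, h2⟩ := hRes ξ
    have h3 := T.adjoint.graph.sub_mem (LinearPMap.le_graph_of_le hST (S.mem_graph p))
      (show (ξ, Complex.I • ξ) ∈ T.adjoint.graph from hξ)
    change (K₀ ξ, (-Complex.I) • K₀ ξ) ∈ T.adjoint.graph
    rw [hK₀, ← h1]
    have e : (-Complex.I) • ((p : E) - ξ) = S p - Complex.I • ξ := by
      rw [eq_sub_of_add_eq h2]
      module
    rw [e]
    exact h3
  let K₁ : defectPlus T →ₗᵢ[ℂ] defectMinus T :=
    { toLinearMap := K₀.restrict hmem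
      norm_map' := by
        intro ξ
        obtain ⟨p, h1, h2⟩ := hRes ξ
        have h3 := norm_add_smul_eq_norm_sub_smul hSs star_I p
        rw [h2, hSp h2, norm_smul, norm_smul, norm_neg] at h3
        have h4 := mul_left_cancel₀ (norm_ne_zero_iff.2 hI) h3
        change ‖K₀ ξ‖ = ‖(ξ : E)‖
        rw [hK₀, ← h1, h4] }
  have hsurj : Function.Surjective K₁ := by
    intro ζ
    obtain ⟨p, hp⟩ := surjective_shift_of_isSelfAdjoint hS star_neg_I
      (neg_ne_zero.2 Complex.I_ne_zero) (-(2 * Complex.I) • (ζ : E))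
    rw [shift_apply] at hp
    have h3 := T.adjoint.graph.sub_mem (LinearPMap.le_graph_of_le hST (S.mem_graph p))
      (show ((ζ : E), (-Complex.I) • (ζ : E)) ∈ T.adjoint.graph from ζ.2)
    have hξ : (p : E) - ζ ∈ defectPlus T := by
      change ((p : E) - ζ, Complex.I • ((p : E) - ζ)) ∈ T.adjoint.graph
      have e : Complex.I • ((p : E) - ζ) = S p - (-Complex.I) • (ζ : E) := by
        rw [eq_sub_of_add_eq hp]
        module
      rw [e]
      exact h3
    refine ⟨⟨(p : E) - ζ, hξ⟩, Subtype.ext ?_⟩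
    change K₀ ((p : E) - ζ) = ζ
    obtain ⟨q, h1, h2⟩ := hRes ((p : E) - ζ)
    have hpq : shift S Complex.I (q - p) = 0 := by
      rw [map_sub, shift_apply, shift_apply, h2, eq_sub_of_add_eq hp]
      module
    have h6 := norm_le_norm_shift hSs star_I (q - p)
    rw [hpq, norm_zero, Complex.norm_I, one_mul] at h6
    have h7 : (q : E) - p = 0 := norm_le_zero_iff.1 h6
    rw [hK₀, ← h1, sub_eq_zero.1 h7]
    abel
  let K := LinearIsometryEquiv.ofSurjective K₁ hsurj
  have hle : vonNeumannExtension T K ≤ S := by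
    refine LinearPMap.le_of_le_graph fun ⟨x, y⟩ h => ?_
    obtain ⟨p, ξ, rfl, rfl⟩ := (vonNeumannExtension_graph T hd hs K x y).1 h
    have hcl : T.closure ≤ S := by
      have h1 := hS.isClosed.isClosable.closure_mono hTS
      refine LinearPMap.le_of_le_graph ((LinearPMap.le_graph_of_le h1).trans ?_)
      rw [← hS.isClosed.isClosable.graph_closure_eq_closure_graph]
      exact Submodule.topologicalClosure_minimal _ le_rfl hS.isClosed
    refine S.graph.add_mem (x := (_, _)) (y := (_, _))
      (LinearPMap.le_graph_of_le hcl (T.closure.mem_graph p)) ?_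
    obtain ⟨q, h1, h2⟩ := hRes ξ
    have hK : (K ξ : E) = q - ξ := by
      rw [h1]
      rfl
    refine (LinearPMap.mem_graph_iff _).2 ⟨q, ?_, ?_⟩
    · change (q : E) = ξ + (K ξ : E)
      rw [hK]
      abel
    · change S q = Complex.I • ((ξ : E) - (K ξ : E))
      rw [hK, eq_sub_of_add_eq h2]
      module
  -- A self-adjoint operator has no proper symmetric extension, so `T_K ≤ S` already forces
  -- equality.
  refine ⟨K, le_antisymm hle (LinearPMap.le_of_le_graph fun ⟨x, y⟩ h => ?_)⟩
  have hK := isSelfAdjoint_vonNeumannExtension hd hs K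
  rw [← LinearPMap.isSelfAdjoint_def.1 hK]
  refine (mem_adjoint_graph_iff hK.dense_domain x y).2 fun p => ?_
  obtain ⟨q, rfl, rfl⟩ := (LinearPMap.mem_graph_iff _).1 h
  rw [hle.2 (x := p) (y := ⟨p, hle.1 p.2⟩) rfl]
  exact hSs _ q

/-- Von Neumann's theorem: the self-adjoint extensions of `T` are parametrized by the unitaries
between the deficiency spaces. -/
theorem bijOn_vonNeumannExtension :
    Set.BijOn (vonNeumannExtension T) Set.univ (selfAdjointExtensions T) :=
  ⟨fun K _ => ⟨isSelfAdjoint_vonNeumannExtension hd hs K, le_vonNeumannExtension hd hs K⟩,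
    (vonNeumannExtension_injective hd hs).injOn,
    fun _ hS => (exists_vonNeumannExtension_eq hd hs hS.1 hS.2).imp fun _ hK => ⟨trivial, hK⟩⟩

end Extension

end VonNeumann

/-! ### Hilbert tensor products, bounded operators on them, and the sum operator -/

section Tensor

variable {E E' F F' G : Type*} [NormedAddCommGroup E] [InnerProductSpace ℂ E]
  [NormedAddCommGroup E'] [InnerProductSpace ℂ E'] [NormedAddCommGroup F] [InnerProductSpace ℂ F]
  [NormedAddCommGroup F'] [InnerProductSpace ℂ F'] [NormedAddCommGroup G] [NormedSpace ℂ G]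

/-- The elementary tensor as a bounded bilinear map. -/
def htmulL (E F : Type*) [NormedAddCommGroup E] [InnerProductSpace ℂ E]
    [NormedAddCommGroup F] [InnerProductSpace ℂ F] : E →L[ℂ] F →L[ℂ] HilbertTensor E F :=
  (ContinuousLinearMap.compL ℂ F (E ⊗[ℂ] F) (HilbertTensor E F)
    (UniformSpace.Completion.toComplL (𝕜 := ℂ) (E := E ⊗[ℂ] F))).comp (TensorProduct.mkL ℂ E F)

theorem htmulL_apply (x : E) (y : F) : htmulL E F x y = htmul x y := rfl

theorem htmul_add_left (x x' : E) (y : F) : htmul (x + x') y = htmul x y + htmul x' y := by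
  simp [← htmulL_apply]

theorem htmul_smul_left (a : ℂ) (x : E) (y : F) : htmul (a • x) y = a • htmul x y := by
  simp [← htmulL_apply]

theorem htmul_add_right (x : E) (y y' : F) : htmul x (y + y') = htmul x y + htmul x y' := by
  simp [← htmulL_apply]

theorem htmul_smul_right (a : ℂ) (x : E) (y : F) : htmul x (a • y) = a • htmul x y := by
  simp [← htmulL_apply]

theorem inner_htmul (x x' : E) (y y' : F) :
    ⟪htmul x y, htmul x' y'⟫ = ⟪x, x'⟫ * ⟪y, y'⟫ := by
  simp [htmul, UniformSpace.Completion.inner_coe]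

theorem norm_htmul (x : E) (y : F) : ‖htmul x y‖ = ‖x‖ * ‖y‖ := by
  simp [htmul, UniformSpace.Completion.norm_coe]

/-- A closed subspace of the Hilbert tensor product which contains the elementary tensors of dense
subspaces is everything. -/
theorem eq_top_of_htmul_mem {X : Set E} {Y : Set F} (hX : Dense X) (hY : Dense Y)
    (S : Submodule ℂ (HilbertTensor E F)) (hS : IsClosed (S : Set (HilbertTensor E F)))
    (h : ∀ x ∈ X, ∀ y ∈ Y, htmul x y ∈ S) : S = ⊤ := by
  have h1 : ∀ x ∈ X, ∀ y, htmul x y ∈ S := fun x hx =>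
    hY.induction (h x hx) (hS.preimage (htmulL E F x).continuous)
  have h2 : ∀ x y, htmul x y ∈ S := by
    intro x y
    exact hX.induction (P := fun x => htmul x y ∈ S) (fun x hx => h1 x hx y)
      (hS.preimage ((htmulL E F).flip y).continuous) x
  refine Submodule.eq_top_iff'.2 fun ξ => ?_
  induction ξ using UniformSpace.Completion.induction_on with
  | hp => exact hS
  | ih t =>
    induction t using TensorProduct.induction_on with
    | zero => exact S.zero_mem
    | tmul x y => exact h2 x y
    | add s t hs ht =>
      rw [UniformSpace.Completion.coe_add]
      exact S.add_mem hs ht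

theorem eq_zero_of_inner_htmul {X : Set E} {Y : Set F} (hX : Dense X) (hY : Dense Y)
    {ξ : HilbertTensor E F} (h : ∀ x ∈ X, ∀ y ∈ Y, ⟪htmul x y, ξ⟫ = 0) : ξ = 0 := by
  have := eq_top_of_htmul_mem hX hY (ℂ ∙ ξ)ᗮ (Submodule.isClosed_orthogonal _) fun x hx y hy => by
    rw [Submodule.mem_orthogonal_singleton_iff_inner_left]
    exact h x hx y hy
  have hξ : ξ ∈ (ℂ ∙ ξ)ᗮ := this ▸ Submodule.mem_top
  rwa [Submodule.mem_orthogonal_singleton_iff_inner_left, inner_self_eq_zero] at hξ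

theorem ext_htmul {f g : HilbertTensor E F →L[ℂ] G} (h : ∀ x y, f (htmul x y) = g (htmul x y)) :
    f = g := by
  have := eq_top_of_htmul_mem dense_univ dense_univ (LinearMap.eqLocus f.toLinearMap g.toLinearMap)
    (isClosed_eq f.continuous g.continuous) fun x _ y _ => h x y
  ext ξ
  exact Submodule.eq_top_iff'.1 this ξ

/-- The tensor product of two bounded operators. -/
def tmap (S : E →L[ℂ] E') (T : F →L[ℂ] F') : HilbertTensor E F →L[ℂ] HilbertTensor E' F' :=
  (TensorProduct.mapL S T).completion

@[simp]
theorem tmap_htmul (S : E →L[ℂ] E') (T : F →L[ℂ] F') (x : E) (y : F) :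
    tmap S T (htmul x y) = htmul (S x) (T y) := by
  simp [tmap, htmul]

theorem norm_tmap_le (S : E →L[ℂ] E') (T : F →L[ℂ] F') : ‖tmap S T‖ ≤ ‖S‖ * ‖T‖ := by
  refine ContinuousLinearMap.opNorm_le_bound _ (by positivity) fun ξ => ?_
  induction ξ using UniformSpace.Completion.induction_on with
  | hp => exact isClosed_le (by fun_prop) (by fun_prop)
  | ih t =>
    rw [tmap, ContinuousLinearMap.completion_apply_coe, UniformSpace.Completion.norm_coe,
      UniformSpace.Completion.norm_coe]
    exact ContinuousLinearMap.le_of_opNorm_le _ (TensorProduct.norm_mapL_le S T) t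

theorem tmap_comp {E'' F'' : Type*} [NormedAddCommGroup E''] [InnerProductSpace ℂ E'']
    [NormedAddCommGroup F''] [InnerProductSpace ℂ F''] (S' : E' →L[ℂ] E'') (T' : F' →L[ℂ] F'')
    (S : E →L[ℂ] E') (T : F →L[ℂ] F') : tmap S' T' ∘L tmap S T = tmap (S' ∘L S) (T' ∘L T) :=
  ext_htmul fun x y => by simp

theorem adjoint_tmap [CompleteSpace E] [CompleteSpace E'] [CompleteSpace F] [CompleteSpace F']
    (S : E →L[ℂ] E') (T : F →L[ℂ] F') : (tmap S T).adjoint = tmap S.adjoint T.adjoint := by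
  refine ext_htmul fun x y => ?_
  rw [← sub_eq_zero]
  refine eq_zero_of_inner_htmul dense_univ dense_univ fun x' _ y' _ => ?_
  rw [inner_sub_right, ContinuousLinearMap.adjoint_inner_right, tmap_htmul, tmap_htmul,
    inner_htmul, inner_htmul, ContinuousLinearMap.adjoint_inner_right,
    ContinuousLinearMap.adjoint_inner_right, sub_self]

section Sum

variable {A : E →ₗ.[ℂ] E} {B : F →ₗ.[ℂ] F}

theorem dense_tensorSum_domain (hA : Dense (A.domain : Set E)) (hB : Dense (B.domain : Set F)) :
    Dense ((tensorSum A B).domain : Set (HilbertTensor E F)) := by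
  rw [Submodule.dense_iff_topologicalClosure_eq_top]
  refine eq_top_of_htmul_mem hA hB _ (Submodule.isClosed_topologicalClosure _) fun x hx y hy => ?_
  exact Submodule.le_topologicalClosure _ (htmul_mem_tensorSum_domain A B ⟨x, hx⟩ ⟨y, hy⟩)

/-- The elementary tensor of two elements of the domains, as an element of the domain of
`A ⊗ I + I ⊗ B`. -/
def domTmul (x : A.domain) (y : B.domain) : (tensorSum A B).domain :=
  ⟨htmul (x : E) (y : F), htmul_mem_tensorSum_domain A B x y⟩

theorem shift_tensorSum_domTmul (c : ℂ) (x : A.domain) (y : B.domain) :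
    shift (tensorSum A B) c (domTmul x y) =
      htmul (A x) (y : F) + htmul (x : E) (B y) + c • htmul (x : E) (y : F) := by
  rw [shift_apply, domTmul, tensorSum_htmul]

@[elab_as_elim]
theorem tensorSum_domain_induction {P : (tensorSum A B).domain → Prop} (zero : P 0)
    (add : ∀ p q, P p → P q → P (p + q)) (tmul : ∀ x y, P (domTmul x y)) (p) : P p := by
  obtain ⟨p, t, rfl⟩ := p
  induction t using TensorProduct.induction_on with
  | zero =>
    convert zero
    exact Subtype.ext (map_zero (tensorIncl A.domain B.domain).toLinearMap)
  | tmul x y => exact tmul x y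
  | add s t hs ht =>
    convert add _ _ hs ht
    exact Subtype.ext (map_add (tensorIncl A.domain B.domain).toLinearMap s t)

theorem isFormalAdjoint_tensorSum (hA : A.IsFormalAdjoint A) (hB : B.IsFormalAdjoint B) :
    (tensorSum A B).IsFormalAdjoint (tensorSum A B) := by
  intro p q
  induction p using tensorSum_domain_induction with
  | zero => simp
  | add p p' hp hp' => simp only [LinearPMap.map_add, inner_add_left, hp, hp', Submodule.coe_add]
  | tmul x y =>
    induction q using tensorSum_domain_induction with
    | zero => simp
    | add p p' hp hp' => simp only [LinearPMap.map_add, inner_add_right, hp, hp', Submodule.coe_add]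
    | tmul x' y' =>
      simp only [domTmul, tensorSum_htmul, inner_add_left, inner_add_right, inner_htmul, hA x x',
        hB y y']

/-- Rewriting the sum through `A + c`, `A - c`, `B + 2c` and `B` prepares the replacement of the
unbounded operators by the Cayley transform of `A` and a bounded function of `B`. -/
theorem mem_adjointEigenspace_tensorSum_iff [CompleteSpace E] [CompleteSpace F]
    (hA : Dense (A.domain : Set E)) (hB : Dense (B.domain : Set F)) {c : ℂ}
    (hc : star c = -c) (hc0 : c ≠ 0) (ξ : HilbertTensor E F) :
    ξ ∈ adjointEigenspace (tensorSum A B) c ↔ ∀ (x : A.domain) (y : B.domain),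
      ⟪htmul (shift A c x) (shift B (2 * c) y) - htmul (shift A (-c) x) (B y), ξ⟫ = 0 := by
  have key : ∀ (x : A.domain) (y : B.domain),
      htmul (shift A c x) (shift B (2 * c) y) - htmul (shift A (-c) x) (B y) =
        (2 * c) • shift (tensorSum A B) c (domTmul x y) := by
    intro x y
    rw [shift_tensorSum_domTmul]
    simp only [shift_apply, htmul_add_left, htmul_add_right,
      htmul_smul_left, htmul_smul_right]
    module
  rw [mem_adjointEigenspace_iff (dense_tensorSum_domain hA hB) hc]
  constructor
  · intro h x y
    rw [key, inner_smul_left, h, mul_zero]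
  · intro h p
    induction p using tensorSum_domain_induction with
    | zero => simp
    | add p q hp hq => rw [map_add, inner_add_left, hp, hq, add_zero]
    | tmul x y =>
      have := h x y
      rw [key, inner_smul_left] at this
      exact (mul_eq_zero.1 this).resolve_left (by simpa using hc0)

end Sum

end Tensor

/-! ### Cayley contraction, resolvents, and decay of powers -/

section Contraction

variable {E : Type*} [NormedAddCommGroup E] [InnerProductSpace ℂ E] [CompleteSpace E]

/-- The Cayley transform of a symmetric operator, extended to a contraction of the whole space. -/
theorem exists_cayley {A : E →ₗ.[ℂ] E} (hs : A.IsFormalAdjoint A) {c : ℂ} (hc : star c = -c) :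
    ∃ V : E →L[ℂ] E, ‖V‖ ≤ 1 ∧ ∀ p, V (shift A c p) = shift A (-c) p := by
  let M := (LinearMap.range (shift A c)).topologicalClosure
  have hM : ∀ p, shift A c p ∈ M := fun p => Submodule.le_topologicalClosure _ ⟨p, rfl⟩
  let e : A.domain →ₗ[ℂ] M := (shift A c).codRestrict M hM
  have he : DenseRange e := by
    intro m
    rw [closure_subtype]
    have hm : (m : E) ∈ closure (LinearMap.range (shift A c) : Set E) := m.2
    convert hm
    ext u
    simp only [Set.mem_image, Set.mem_range]
    constructor
    · rintro ⟨_, ⟨p, rfl⟩, rfl⟩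
      exact ⟨p, rfl⟩
    · rintro ⟨p, rfl⟩
      exact ⟨_, ⟨p, rfl⟩, rfl⟩
  have hnorm : ∀ p, ‖shift A (-c) p‖ ≤ 1 * ‖e p‖ := by
    intro p
    rw [one_mul]
    refine le_of_eq ?_
    change _ = ‖shift A c p‖
    rw [shift_apply, shift_apply, norm_add_smul_eq_norm_sub_smul hs hc, neg_smul, sub_eq_add_neg]
  -- The isometry `(A + c) p ↦ (A - c) p` is extended by continuity to the closure of the range and
  -- by zero on the orthogonal complement.
  refine ⟨(shift A (-c)).extendOfNorm e ∘L M.orthogonalProjectionOnto, ?_, fun p => ?_⟩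
  · calc _ ≤ ‖(shift A (-c)).extendOfNorm e‖ * ‖M.orthogonalProjectionOnto‖ :=
        ContinuousLinearMap.opNorm_comp_le _ _
      _ ≤ 1 * 1 := by
        gcongr
        · exact LinearMap.opNorm_extendOfNorm_le he zero_le_one hnorm
        · exact Submodule.orthogonalProjectionOnto_norm_le M
      _ = 1 := one_mul 1
  · rw [ContinuousLinearMap.comp_apply,
      show M.orthogonalProjectionOnto (shift A c p) = e p from
        Submodule.orthogonalProjectionOnto_mem_subspace_eq_self (e p)]
    exact LinearMap.extendOfNorm_eq he ⟨1, hnorm⟩ p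

-- The third power of `R` is what makes the decay `‖Gᵏ R³ y‖ = O(k^(-3/2))` summable; with `R²` the
-- same argument would give only `O(1/k)`.
omit [CompleteSpace E] in
theorem pow_mul_norm_sq_le {G R : E →L[ℂ] E} (hGR : Commute G R)
    (h : ∀ y, ‖G y‖ ^ 2 + 4 * ‖R y‖ ^ 2 = ‖y‖ ^ 2) (y : E) (k : ℕ) :
    (k : ℝ) ^ 3 * ‖(G ^ k) ((R ^ 3) y)‖ ^ 2 ≤ ‖y‖ ^ 2 := by
  let b : ℕ → ℕ → ℝ := fun m k => ‖(R ^ m) ((G ^ k) y)‖ ^ 2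
  have hb0 : ∀ m k, 0 ≤ b m k := fun m k => sq_nonneg _
  have hb : ∀ m k, b m (k + 1) = b m k - 4 * b (m + 1) k := by
    intro m k
    have h1 : (R ^ m) ((G ^ (k + 1)) y) = G ((R ^ m) ((G ^ k) y)) := by
      rw [pow_succ' G]
      exact congrArg (fun S : E →L[ℂ] E => S ((G ^ k) y)) (hGR.pow_right m).eq.symm
    have h2 : (R ^ (m + 1)) ((G ^ k) y) = R ((R ^ m) ((G ^ k) y)) := by
      rw [pow_succ']
      rfl
    simp only [b, h1, h2, ← h ((R ^ m) ((G ^ k) y))]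
    ring
  -- This weighted sum does not increase with `k`: by `hb`, the loss `-4 b (m + 1) k` in each term
  -- outweighs the growth of the next weight.
  have hE : ∀ k : ℕ, b 0 k + k * b 1 k + k ^ 2 * b 2 k + k ^ 3 * b 3 k ≤ ‖y‖ ^ 2 := by
    intro k
    induction k with
    | zero => simp [b]
    | succ k ih =>
      refine le_trans ?_ ih
      have hk : (0 : ℝ) ≤ k := Nat.cast_nonneg k
      rw [hb, hb, hb, hb]
      push_cast
      have h1 := hb0 1 k
      have h2 := mul_nonneg (by linarith : (0 : ℝ) ≤ 2 * k + 3) (hb0 2 k)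
      have h3 := mul_nonneg (by positivity : (0 : ℝ) ≤ k ^ 2 + 5 * k + 3) (hb0 3 k)
      have h4 := mul_nonneg (by positivity : (0 : ℝ) ≤ ((k : ℝ) + 1) ^ 3) (hb0 4 k)
      nlinarith
  have h3 : (G ^ k) ((R ^ 3) y) = (R ^ 3) ((G ^ k) y) :=
    congrArg (fun S : E →L[ℂ] E => S y) (hGR.pow_pow k 3).eq
  rw [h3]
  have hk : (0 : ℝ) ≤ k := Nat.cast_nonneg k
  have h5 := mul_nonneg hk (hb0 1 k)
  have h6 := mul_nonneg (sq_nonneg (k : ℝ)) (hb0 2 k)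
  have := hE k
  have h7 := hb0 0 k
  simp only [b] at *
  linarith

omit [CompleteSpace E] in
theorem summable_norm_pow_apply {G R : E →L[ℂ] E} (hGR : Commute G R)
    (h : ∀ y, ‖G y‖ ^ 2 + 4 * ‖R y‖ ^ 2 = ‖y‖ ^ 2) (y : E) :
    Summable fun k : ℕ => ‖(G ^ k) ((R ^ 3) y)‖ := by
  have hs : Summable fun k : ℕ => ‖y‖ * (k : ℝ) ^ (-(3 / 2) : ℝ) :=
    (Real.summable_nat_rpow.2 (by norm_num)).mul_left _
  -- The term `k = 0` is dropped, because there the real power in the bound takes the value `0`.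
  rw [← summable_nat_add_iff 1]
  refine Summable.of_nonneg_of_le (fun _ => norm_nonneg _) (fun k => ?_)
    ((summable_nat_add_iff 1).2 hs)
  have hk : (0 : ℝ) < ((k + 1 : ℕ) : ℝ) := by positivity
  have h1 := pow_mul_norm_sq_le hGR h y (k + 1)
  refine le_of_sq_le_sq ?_ (by positivity)
  rw [mul_pow, ← Real.rpow_natCast (_ ^ _) 2, ← Real.rpow_mul hk.le]
  norm_num only [Nat.cast_ofNat]
  rw [Real.rpow_neg hk.le, ← div_eq_mul_inv, le_div_iff₀ (by positivity), mul_comm]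
  exact_mod_cast h1

/-- The resolvents of a self-adjoint operator at `∓ 2 c`. -/
theorem exists_resolvent_pair {B : E →ₗ.[ℂ] E} (hB : IsSelfAdjoint B) {c : ℂ}
    (hc : star c = -c) (hc1 : ‖c‖ = 1) :
    ∃ R R' : E →L[ℂ] E, DenseRange R ∧ DenseRange R' ∧ R'.adjoint = R ∧
      (∀ y, R' (shift B (2 * c) y) = y) ∧
      ∀ y, ‖y + (2 * c) • R y‖ ^ 2 + 4 * ‖R y‖ ^ 2 = ‖y‖ ^ 2 := by
  have hs := isFormalAdjoint_of_isSelfAdjoint hB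
  have hc0 : 2 * c ≠ 0 := by
    rw [← norm_ne_zero_iff]
    simp [hc1]
  have hc2 : star (2 * c) = -(2 * c) := by
    rw [star_mul', hc]
    simp
  have hc3 : star (-(2 * c)) = -(-(2 * c)) := by rw [star_neg, hc2]
  obtain ⟨R', hR'⟩ := exists_resolvent hB hc2 hc0
  obtain ⟨R, hR⟩ := exists_resolvent hB hc3 (neg_ne_zero.2 hc0)
  have hinv : ∀ {d : ℂ} {Q : E →L[ℂ] E}, star d = -d → d ≠ 0 →
      (∀ f, ∃ p : B.domain, Q f = p ∧ shift B d p = f) → ∀ y, Q (shift B d y) = y := by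
    intro d Q hd hd0 hQ y
    obtain ⟨p, h1, h2⟩ := hQ (shift B d y)
    have h3 := norm_le_norm_shift hs hd (p - y)
    rw [map_sub, h2, sub_self, norm_zero] at h3
    have h4 := norm_le_zero_iff.1 (nonpos_of_mul_nonpos_right h3 (norm_pos_iff.2 hd0))
    rw [h1]
    exact sub_eq_zero.1 h4
  have hdense : ∀ {d : ℂ} {Q : E →L[ℂ] E}, (∀ y, Q (shift B d y) = y) → DenseRange Q := by
    intro d Q hQ
    refine hB.dense_domain.mono fun y hy => ?_
    exact ⟨_, hQ ⟨y, hy⟩⟩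
  have h1 := hinv hc2 hc0 hR'
  have h2 := hinv hc3 (neg_ne_zero.2 hc0) hR
  refine ⟨R, R', hdense h2, hdense h1, ?_, h1, fun f => ?_⟩
  · symm
    rw [ContinuousLinearMap.eq_adjoint_iff]
    intro f g
    obtain ⟨p, hp1, hp2⟩ := hR f
    obtain ⟨q, hq1, hq2⟩ := hR' g
    rw [hp1, hq1, ← hp2, ← hq2, shift_apply, shift_apply, inner_add_left, inner_add_right,
      inner_smul_left, inner_smul_right, starRingEnd_apply, hc3, hs p q, neg_neg]
  -- With `f = (B - 2c) p` one has `f + 2c R f = B p`, so this is the graph norm identity for `B -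
  -- 2c`.
  · obtain ⟨p, hp1, rfl⟩ := hR f
    have h3 := norm_add_smul_sq_of_symm hs hc3 p
    rw [hp1, shift_apply, h3, neg_smul, neg_add_cancel_right, norm_neg, norm_mul, hc1]
    norm_num

end Contraction

/-! ### Polar decomposition -/

section Polar

variable {H₁ H₂ : Type*} [NormedAddCommGroup H₁] [InnerProductSpace ℂ H₁] [CompleteSpace H₁]
  [NormedAddCommGroup H₂] [InnerProductSpace ℂ H₂] [CompleteSpace H₂]

theorem exists_sqrt (Φ : H₁ →L[ℂ] H₂) :
    ∃ P : H₁ →L[ℂ] H₁, P ∘L P = Φ.adjoint ∘L Φ ∧ P.adjoint = P := by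
  have hpos : 0 ≤ Φ.adjoint ∘L Φ :=
    (ContinuousLinearMap.nonneg_iff_isPositive _).2 Φ.isPositive_adjoint_comp_self
  obtain ⟨P, hP, h⟩ := CStarAlgebra.nonneg_iff_exists_isSelfAdjoint_and_eq_mul_self.1 hpos
  exact ⟨P, h.symm, ContinuousLinearMap.isSelfAdjoint_iff'.1 hP⟩

/-- The unitary part of the polar decomposition of an injective operator with dense range. -/
theorem nonempty_linearIsometryEquiv_of_injective_of_denseRange (Φ : H₁ →L[ℂ] H₂)
    (hinj : Function.Injective Φ) (hd : DenseRange Φ) : Nonempty (H₁ ≃ₗᵢ[ℂ] H₂) := by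
  obtain ⟨P, hP, hPsa⟩ := exists_sqrt Φ
  have hnorm : ∀ x, ‖Φ x‖ = ‖P x‖ := by
    intro x
    have h1 : ⟪P x, P x⟫ = ⟪Φ x, Φ x⟫ := by
      rw [← ContinuousLinearMap.adjoint_inner_left, hPsa,
        ← ContinuousLinearMap.adjoint_inner_left Φ]
      exact congrArg (fun S : H₁ →L[ℂ] H₁ => ⟪S x, x⟫) hP
    rw [inner_self_eq_norm_sq_to_K, inner_self_eq_norm_sq_to_K] at h1
    have h2 : ‖P x‖ ^ 2 = ‖Φ x‖ ^ 2 := by exact_mod_cast h1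
    exact ((sq_eq_sq₀ (norm_nonneg _) (norm_nonneg _)).1 h2).symm
  have hPd : DenseRange P := by
    have : (LinearMap.range P.toLinearMap).topologicalClosure = ⊤ := by
      rw [Submodule.topologicalClosure_eq_top_iff, Submodule.eq_bot_iff]
      intro x hx
      have h1 : P x = 0 := by
        refine ext_inner_left ℂ fun y => ?_
        rw [inner_zero_right, ← hPsa, ContinuousLinearMap.adjoint_inner_right]
        exact (Submodule.mem_orthogonal _ _).1 hx _ ⟨y, rfl⟩
      have h2 := hnorm x
      rw [h1, norm_zero, norm_eq_zero] at h2
      exact hinj (h2.trans (map_zero Φ).symm)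
    exact (Submodule.dense_iff_topologicalClosure_eq_top).2 this
  exact ⟨(LinearEquiv.refl ℂ H₁).extendOfIsometry P.toLinearMap Φ.toLinearMap hPd hd hnorm⟩

end Polar

/-! ### The deficiency spaces of the sum -/

section Deficiency

variable {E F : Type*} [NormedAddCommGroup E] [InnerProductSpace ℂ E] [CompleteSpace E]
  [NormedAddCommGroup F] [InnerProductSpace ℂ F] [CompleteSpace F]

theorem completeSpace_adjointEigenspace {T : E →ₗ.[ℂ] E} (hd : Dense (T.domain : Set E)) (z : ℂ) :
    CompleteSpace (adjointEigenspace T z) := by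
  have h : IsClosed (T.adjoint.graph : Set (E × E)) := LinearPMap.adjoint_isClosed hd
  have h2 : IsClosed (adjointEigenspace T z : Set E) :=
    h.preimage (f := fun x : E => (x, z • x)) (by fun_prop)
  exact h2.completeSpace_coe

theorem dense_adjointEigenspace_sup_range {T : E →ₗ.[ℂ] E} (hd : Dense (T.domain : Set E)) {c : ℂ}
    (hc : star c = -c) :
    Dense ((adjointEigenspace T c ⊔ LinearMap.range (shift T c) : Submodule ℂ E) : Set E) := by
  rw [Submodule.dense_iff_topologicalClosure_eq_top, Submodule.topologicalClosure_eq_top_iff,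
    Submodule.eq_bot_iff]
  intro x hx
  rw [Submodule.mem_orthogonal] at hx
  have h1 : x ∈ adjointEigenspace T c := (mem_adjointEigenspace_iff hd hc x).2 fun p =>
    hx _ (Submodule.mem_sup_right ⟨p, rfl⟩)
  exact inner_self_eq_zero.1 (hx x (Submodule.mem_sup_left h1))

section Intertwiner

variable {V : E →L[ℂ] E}

omit [CompleteSpace E] [CompleteSpace F] in
theorem tmap_pow_htmul (V : E →L[ℂ] E) (G : F →L[ℂ] F) (x : E) (y : F) (k : ℕ) :
    (tmap V G ^ k) (htmul x y) = htmul ((V ^ k) x) ((G ^ k) y) := by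
  induction k with
  | zero => simp
  | succ k ih =>
    rw [pow_succ', mul_apply_eq_comp, ih, tmap_htmul, pow_succ', pow_succ']
    rfl

/-- The norm identity `|G η|² + 4 |R η|² = |η|²` is inherited by `I ⊗ G` and `I ⊗ R`. -/
theorem norm_tmap_id_sq_add {G R : F →L[ℂ] F}
    (h : ∀ y, ‖G y‖ ^ 2 + 4 * ‖R y‖ ^ 2 = ‖y‖ ^ 2) (ξ : HilbertTensor E F) :
    ‖tmap (.id ℂ E) G ξ‖ ^ 2 + 4 * ‖tmap (.id ℂ E) R ξ‖ ^ 2 = ‖ξ‖ ^ 2 := by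
  have h1 : G.adjoint ∘L G + (4 : ℂ) • (R.adjoint ∘L R) = .id ℂ F := by
    refine ContinuousLinearMap.coe_injective ((ext_inner_map _ _).1 fun y => ?_)
    simp only [ContinuousLinearMap.coe_coe, add_apply,
      smul_apply, ContinuousLinearMap.comp_apply, inner_add_left,
      inner_smul_left, ContinuousLinearMap.adjoint_inner_left, ContinuousLinearMap.id_apply,
      inner_self_eq_norm_sq_to_K, map_ofNat]
    have h0 := congrArg (fun r : ℝ => (r : ℂ)) (h y)
    push_cast at h0
    exact h0
  have h2 : (tmap (.id ℂ E) G).adjoint ∘L tmap (.id ℂ E) G +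
      (4 : ℂ) • ((tmap (.id ℂ E) R).adjoint ∘L tmap (.id ℂ E) R) =
        .id ℂ (HilbertTensor E F) := by
    refine ext_htmul fun x y => ?_
    have h3 := congrArg (fun S : F →L[ℂ] F => htmul x (S y)) h1
    simpa [adjoint_tmap, htmul_add_right, htmul_smul_right, ContinuousLinearMap.adjoint_id] using h3
  have h3 := congrArg (fun S : HilbertTensor E F →L[ℂ] HilbertTensor E F => ⟪S ξ, ξ⟫) h2
  simp only [add_apply, smul_apply,
    ContinuousLinearMap.comp_apply, inner_add_left, inner_smul_left,
    ContinuousLinearMap.adjoint_inner_left, ContinuousLinearMap.id_apply,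
    inner_self_eq_norm_sq_to_K, map_ofNat] at h3
  refine Complex.ofReal_injective ?_
  push_cast
  exact h3

/-- If `V` is a contraction and `G` is a strict contraction pointwise, then `I - V ⊗ G` is
injective. -/
theorem eq_zero_of_tmap_eq_self {G R : F →L[ℂ] F} (hV : ‖V‖ ≤ 1)
    (h : ∀ y, ‖G y‖ ^ 2 + 4 * ‖R y‖ ^ 2 = ‖y‖ ^ 2) (hR : DenseRange R.adjoint)
    {ξ : HilbertTensor E F} (hξ : tmap V G ξ = ξ) : ξ = 0 := by
  -- Since `V ⊗ I` is a contraction, a fixed vector loses no norm under `I ⊗ G`; the norm identity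
  -- then forces `(I ⊗ R) ξ = 0`.
  have h1 : ‖ξ‖ ≤ ‖tmap (.id ℂ E) G ξ‖ := by
    have h2 : tmap V (.id ℂ F) ∘L tmap (.id ℂ E) G = tmap V G := by
      rw [tmap_comp, ContinuousLinearMap.comp_id, ContinuousLinearMap.id_comp]
    calc ‖ξ‖ = ‖tmap V (.id ℂ F) (tmap (.id ℂ E) G ξ)‖ := by
          rw [← ContinuousLinearMap.comp_apply, h2, hξ]
      _ ≤ 1 * ‖tmap (.id ℂ E) G ξ‖ := by
          refine ContinuousLinearMap.le_of_opNorm_le _ ((norm_tmap_le _ _).trans ?_) _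
          exact mul_le_one₀ hV (norm_nonneg _) ContinuousLinearMap.norm_id_le
      _ = _ := one_mul _
  have h2 := norm_tmap_id_sq_add h ξ
  have h3 : tmap (.id ℂ E) R ξ = 0 := by
    rw [← norm_eq_zero, ← sq_eq_zero_iff]
    have := pow_le_pow_left₀ (norm_nonneg _) h1 2
    nlinarith [sq_nonneg ‖tmap (.id ℂ E) R ξ‖]
  refine eq_zero_of_inner_htmul dense_univ hR ?_
  rintro x - _ ⟨f, rfl⟩
  have h4 : htmul x (R.adjoint f) = (tmap (.id ℂ E) R).adjoint (htmul x f) := by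
    simp [adjoint_tmap, ContinuousLinearMap.adjoint_id]
  rw [h4, ContinuousLinearMap.adjoint_inner_left, h3, inner_zero_right]

omit [CompleteSpace E] [CompleteSpace F] in
/-- The Neumann series for `I - V ⊗ G` converges on a dense set of elementary tensors. -/
theorem exists_sub_tmap_eq {G R : F →L[ℂ] F} (hV : ‖V‖ ≤ 1) (hGR : Commute G R)
    (h : ∀ y, ‖G y‖ ^ 2 + 4 * ‖R y‖ ^ 2 = ‖y‖ ^ 2) (x : E) (y : F) :
    ∃ ξ, ξ - tmap V G ξ = htmul x ((R ^ 3) y) := by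
  -- The terms of the Neumann series for `(I - V ⊗ G)⁻¹` applied to `x ⊗ R³ y`.
  let a : ℕ → HilbertTensor E F := fun k => (tmap V G ^ k) (htmul x ((R ^ 3) y))
  have ha : Summable a := by
    refine Summable.of_norm_bounded ((summable_norm_pow_apply hGR h y).mul_left ‖x‖) fun k => ?_
    simp only [a]
    rw [tmap_pow_htmul, norm_htmul]
    gcongr
    calc ‖(V ^ k) x‖ ≤ ‖V ^ k‖ * ‖x‖ := ContinuousLinearMap.le_opNorm _ _
      _ ≤ 1 * ‖x‖ := by
        gcongr
        -- The identity has norm `0` on the trivial space, so `k = 0` needs the bound `≤ 1`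
        -- separately.
        rcases Nat.eq_zero_or_pos k with rfl | hk
        · rw [pow_zero]
          exact ContinuousLinearMap.norm_id_le
        · exact (norm_pow_le' V hk).trans (pow_le_one₀ (norm_nonneg _) hV)
      _ = ‖x‖ := one_mul _
  refine ⟨∑' k, a k, ?_⟩
  have h1 : tmap V G (∑' k, a k) = ∑' k, a (k + 1) := by
    rw [ContinuousLinearMap.map_tsum _ ha]
    refine tsum_congr fun k => ?_
    change _ = (tmap V G ^ (k + 1)) (htmul x ((R ^ 3) y))
    rw [pow_succ' (tmap V G)]
    rfl
  rw [h1, ha.tsum_eq_zero_add, add_sub_cancel_right]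
  simp [a]

end Intertwiner

/-- The deficiency space of `A ⊗ I + I ⊗ B` is unitarily equivalent to the tensor product of the
deficiency space of `A` with the second factor. -/
theorem nonempty_adjointEigenspace_tensorSum_equiv {A : E →ₗ.[ℂ] E}
    (hd : Dense (A.domain : Set E)) (hs : A.IsFormalAdjoint A) {B : F →ₗ.[ℂ] F}
    (hB : IsSelfAdjoint B) {c : ℂ} (hc : star c = -c) (hc1 : ‖c‖ = 1) :
    Nonempty (adjointEigenspace (tensorSum A B) c ≃ₗᵢ[ℂ]
      HilbertTensor (adjointEigenspace A c) F) := by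
  have hc0 : c ≠ 0 := by
    rw [← norm_ne_zero_iff, hc1]
    exact one_ne_zero
  have hdAB := dense_tensorSum_domain hd hB.dense_domain
  have := completeSpace_adjointEigenspace hd c
  have := completeSpace_adjointEigenspace hdAB c
  obtain ⟨V, hV, hVA⟩ := exists_cayley hs hc
  obtain ⟨R, R', hR, hR', hadj, hR'B, hnorm⟩ := exists_resolvent_pair hB hc hc1
  -- `G` is `B (B - 2c)⁻¹` and `G'` is `B (B + 2c)⁻¹`, written as bounded operators.
  let G : F →L[ℂ] F := .id ℂ F + (2 * c) • R
  let G' : F →L[ℂ] F := .id ℂ F - (2 * c) • R'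
  have hGadj : G'.adjoint = G := by
    simp only [G, G', map_sub, LinearIsometryEquiv.map_smulₛₗ, hadj, ContinuousLinearMap.adjoint_id,
      map_mul, starRingEnd_apply, hc, map_ofNat]
    module
  have hGR : Commute G R := (Commute.one_left R).add_left ((Commute.refl R).smul_left _)
  have hG'B : ∀ y, G' (shift B (2 * c) y) = B y := by
    intro y
    simp only [G', sub_apply, smul_apply, hR'B, ContinuousLinearMap.id_apply]
    rw [shift_apply, add_sub_cancel_right]
  have hVadj : ‖V.adjoint‖ ≤ 1 := by rwa [LinearIsometryEquiv.norm_map]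
  have hRadj : R.adjoint = R' := by rw [← hadj, ContinuousLinearMap.adjoint_adjoint]
  let N := adjointEigenspace A c
  let D : HilbertTensor E F →L[ℂ] HilbertTensor E F := .id ℂ _ - tmap V.adjoint G
  have hmem : ∀ ξ, ξ ∈ adjointEigenspace (tensorSum A B) c ↔
      ∀ x f, ⟪htmul (shift A c x) f, D ξ⟫ = 0 := by
    intro ξ
    have hinner : ∀ x y, ⟪htmul (shift A c x) (shift B (2 * c) y), D ξ⟫ =
        ⟪htmul (shift A c x) (shift B (2 * c) y) - htmul (shift A (-c) x) (B y), ξ⟫ := by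
      intro x y
      rw [inner_sub_left, ← hVA, ← hG'B, ← tmap_htmul, ← ContinuousLinearMap.adjoint_inner_right,
        adjoint_tmap, hGadj, ← inner_sub_right]
      rfl
    rw [mem_adjointEigenspace_tensorSum_iff hd hB.dense_domain hc hc0]
    refine forall_congr' fun x => ⟨fun h f => ?_, fun h y => (hinner x y).symm.trans (h _)⟩
    obtain ⟨y, rfl⟩ := surjective_shift_of_isSelfAdjoint hB (c := 2 * c)
      (by rw [star_mul', hc]; simp) (by simpa using hc0) f
    exact (hinner x y).trans (h y)
  let Q : HilbertTensor E F →L[ℂ] HilbertTensor N F :=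
    tmap N.orthogonalProjectionOnto (.id ℂ F)
  -- `D` already maps the deficiency space into `N ⊗ F`; the projection `Q` only makes that the
  -- codomain.
  let Φ : adjointEigenspace (tensorSum A B) c →L[ℂ] HilbertTensor N F :=
    Q ∘L D ∘L (adjointEigenspace (tensorSum A B) c).subtypeL
  refine nonempty_linearIsometryEquiv_of_injective_of_denseRange Φ ?_ ?_
  · rw [injective_iff_map_eq_zero]
    intro ξ hξ
    -- `D ξ` is orthogonal to `N ⊗ F` because `Q (D ξ) = 0`, and to `ran (A + c) ⊗ F` by `hmem`;
    -- together these tensors are total.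
    have hn : ∀ (n : N) f, ⟪htmul (n : E) f, D ξ⟫ = 0 := by
      intro n f
      have h1 : htmul (n : E) f = Q.adjoint (htmul n f) := by
        simp only [Q, adjoint_tmap, tmap_htmul, ContinuousLinearMap.adjoint_id,
          ← Submodule.adjoint_subtypeL, ContinuousLinearMap.adjoint_adjoint]
        rfl
      rw [h1, ContinuousLinearMap.adjoint_inner_left]
      exact (congrArg _ hξ).trans (inner_zero_right _)
    have hD : D ξ = 0 := by
      refine eq_zero_of_inner_htmul (dense_adjointEigenspace_sup_range hd hc) dense_univ ?_
      rintro x hx f -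
      obtain ⟨n, hn', _, ⟨p, rfl⟩, rfl⟩ := Submodule.mem_sup.1 hx
      rw [htmul_add_left, inner_add_left, hn ⟨n, hn'⟩, (hmem ξ).1 ξ.2, add_zero]
    exact Subtype.ext (eq_zero_of_tmap_eq_self hVadj hnorm (hRadj ▸ hR')
      (sub_eq_zero.1 hD).symm)
  · have hR3 : DenseRange ⇑(R ^ 3) := by
      exact (hR.comp hR R.continuous).comp hR (R.continuous.comp R.continuous)
    have := eq_top_of_htmul_mem (X := (Set.univ : Set N)) dense_univ hR3
      (LinearMap.range Φ.toLinearMap).topologicalClosure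
      (Submodule.isClosed_topologicalClosure _) ?_
    · exact Submodule.dense_iff_topologicalClosure_eq_top.2 this
    · rintro n - _ ⟨y, rfl⟩
      refine Submodule.le_topologicalClosure _ ?_
      obtain ⟨ξ, hξ⟩ := exists_sub_tmap_eq hVadj hGR hnorm (n : E) y
      have hDξ : D ξ = htmul (n : E) ((R ^ 3) y) := hξ
      have hξN : ξ ∈ adjointEigenspace (tensorSum A B) c := by
        refine (hmem ξ).2 fun x f => ?_
        rw [hDξ, inner_htmul, (mem_adjointEigenspace_iff hd hc n).1 n.2, zero_mul]
      refine ⟨⟨ξ, hξN⟩, ?_⟩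
      change Q (D ξ) = _
      rw [hDξ]
      simp only [Q, tmap_htmul, Submodule.orthogonalProjectionOnto_mem_subspace_eq_self,
        ContinuousLinearMap.id_apply]

end Deficiency

/-! ### Existence of non-decomposable unitaries -/

section Decomposable

variable {M N F : Type*} [NormedAddCommGroup M] [InnerProductSpace ℂ M]
  [NormedAddCommGroup N] [InnerProductSpace ℂ N] [NormedAddCommGroup F] [InnerProductSpace ℂ F]

theorem exists_orthonormal_pair (h : 1 < Module.rank ℂ M) :
    ∃ e₁ e₂ : M, ‖e₁‖ = 1 ∧ ‖e₂‖ = 1 ∧ ⟪e₁, e₂⟫ = 0 := by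
  have : Nontrivial M := rank_pos_iff_nontrivial.1 (zero_lt_one.trans h)
  obtain ⟨v, hv⟩ := exists_ne (0 : M)
  have hne : (ℂ ∙ v)ᗮ ≠ ⊥ := by
    intro hb
    have htop : (ℂ ∙ v) = ⊤ := by
      rwa [← Submodule.orthogonal_eq_bot_iff]
    have h1 := rank_span_le (R := ℂ) ({v} : Set M)
    rw [htop, rank_top, Cardinal.mk_singleton] at h1
    exact absurd h (not_lt.2 h1)
  obtain ⟨w, hw, hw0⟩ := Submodule.exists_mem_ne_zero_of_ne_bot hne
  refine ⟨((‖v‖⁻¹ : ℝ) : ℂ) • v, ((‖w‖⁻¹ : ℝ) : ℂ) • w, ?_, ?_, ?_⟩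
  · simp [norm_smul, hv]
  · simp [norm_smul, hw0]
  · rw [inner_smul_left, inner_smul_right, Submodule.mem_orthogonal_singleton_iff_inner_right.1 hw]
    simp

/-- A reflection in the orthogonal complement of an elementary tensor is not decomposable. -/
theorem exists_not_isDecomposable_self (hM : 1 < Module.rank ℂ M) (hF : 1 < Module.rank ℂ F) :
    ∃ Z : HilbertTensor M F ≃ₗᵢ[ℂ] HilbertTensor M F, ¬ IsDecomposable Z := by
  obtain ⟨e₁, e₂, he₁, he₂, he⟩ := exists_orthonormal_pair hM
  obtain ⟨f₁, f₂, hf₁, hf₂, hf⟩ := exists_orthonormal_pair hF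
  let t : HilbertTensor M F := htmul e₁ f₁
  refine ⟨(ℂ ∙ t)ᗮ.reflection, ?_⟩
  rintro ⟨U, V, h⟩
  have hfix : ∀ x y, ⟪t, htmul x y⟫ = 0 → ‖x‖ = 1 → ‖y‖ = 1 → ⟪x, U x⟫ * ⟪y, V y⟫ = 1 := by
    intro x y h0 hx hy
    have h1 : (ℂ ∙ t)ᗮ.reflection (htmul x y) = htmul x y :=
      Submodule.reflection_mem_subspace_eq_self
        (Submodule.mem_orthogonal_singleton_iff_inner_right.2 h0)
    rw [← inner_htmul, ← h, h1, inner_htmul, inner_self_eq_norm_sq_to_K,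
      inner_self_eq_norm_sq_to_K, hx, hy]
    simp
  have h11 : ⟪e₁, U e₁⟫ * ⟪f₁, V f₁⟫ = -1 := by
    have h1 : (ℂ ∙ t)ᗮ.reflection t = -t :=
      Submodule.reflection_orthogonalComplement_singleton_eq_neg t
    rw [← inner_htmul, ← h]
    change ⟪t, (ℂ ∙ t)ᗮ.reflection t⟫ = -1
    rw [h1, inner_neg_right, inner_htmul, inner_self_eq_norm_sq_to_K,
      inner_self_eq_norm_sq_to_K, he₁, hf₁]
    simp
  have h12 := hfix e₁ f₂ (by simp [t, inner_htmul, hf]) he₁ hf₂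
  have h21 := hfix e₂ f₁ (by simp [t, inner_htmul, he]) he₂ hf₁
  have h22 := hfix e₂ f₂ (by simp [t, inner_htmul, he]) he₂ hf₂
  -- With `aᵢ = ⟪eᵢ, U eᵢ⟫` and `bⱼ = ⟪fⱼ, V fⱼ⟫`, the products `(a₁ b₁)(a₂ b₂) = -1` and `(a₁
  -- b₂)(a₂ b₁) = 1` would be equal.
  have : (-1 : ℂ) = 1 := by
    linear_combination (⟪e₁, U e₁⟫ * ⟪f₂, V f₂⟫) * h21 + h12 - (⟪e₂, U e₂⟫ * ⟪f₂, V f₂⟫) * h11 + h22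
  norm_num at this

theorem exists_not_isDecomposable (W₀ : HilbertTensor M F ≃ₗᵢ[ℂ] HilbertTensor N F)
    (hF : 1 < Module.rank ℂ F) (h : 1 < Module.rank ℂ M ∨ 1 < Module.rank ℂ N) :
    ∃ W : HilbertTensor M F ≃ₗᵢ[ℂ] HilbertTensor N F, ¬ IsDecomposable W := by
  by_cases hW : IsDecomposable W₀
  · obtain ⟨U, V, hUV⟩ := hW
    -- The unitary `U` identifies `M` with `N`, so either rank hypothesis gives the one on `M`.
    have hM : 1 < Module.rank ℂ M := by
      rcases h with h | h
      · exact h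
      · have := U.toLinearEquiv.lift_rank_eq
        rw [← Cardinal.one_lt_lift_iff, ← this] at h
        exact Cardinal.one_lt_lift_iff.1 h
    obtain ⟨Z, hZ⟩ := exists_not_isDecomposable_self hM hF
    refine ⟨Z.trans W₀, fun ⟨U', V', h'⟩ => hZ ⟨U'.trans U.symm, V'.trans V.symm, fun x y => ?_⟩⟩
    apply W₀.injective
    rw [hUV]
    simpa using h' x y
  · exact ⟨W₀, hW⟩

end Decomposable

theorem bijOn_extensionOf {E F : Type*} [NormedAddCommGroup E] [InnerProductSpace ℂ E]
    [CompleteSpace E] [NormedAddCommGroup F] [InnerProductSpace ℂ F] {A : E →ₗ.[ℂ] E}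
    {B : F →ₗ.[ℂ] F} (hd : Dense ((tensorSum A B).domain : Set (HilbertTensor E F)))
    (hs : (tensorSum A B).IsFormalAdjoint (tensorSum A B))
    (Jp : defectPlus (tensorSum A B) ≃ₗᵢ[ℂ] HilbertTensor (defectPlus A) F)
    (Jm : defectMinus (tensorSum A B) ≃ₗᵢ[ℂ] HilbertTensor (defectMinus A) F) :
    Set.BijOn (extensionOf A B Jp Jm) Set.univ (selfAdjointExtensions (tensorSum A B)) := by
  refine (bijOn_vonNeumannExtension hd hs).comp (g := vonNeumannExtension (tensorSum A B))
    (f := fun W => (Jp.trans W).trans Jm.symm) ⟨fun _ _ => trivial, ?_, ?_⟩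
  · intro W _ W' _ h
    ext ξ
    have := DFunLike.congr_fun h (Jp.symm ξ)
    simpa using this
  · intro K _
    refine ⟨(Jp.symm.trans K).trans Jm, trivial, ?_⟩
    ext ξ
    simp

end DeficiencyTensor

end

theorem mainTheorem4 {E F : Type*} [NormedAddCommGroup E] [InnerProductSpace ℂ E] [CompleteSpace E]
    [NormedAddCommGroup F] [InnerProductSpace ℂ F] [CompleteSpace F]
    (A : E →ₗ.[ℂ] E) (hA_dense : Dense (A.domain : Set E)) (hA_symm : A.IsFormalAdjoint A)
    (B : F →ₗ.[ℂ] F) (hB : IsSelfAdjoint B) :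
    (Dense ((tensorSum A B).domain : Set (HilbertTensor E F)) ∧
      (tensorSum A B).IsFormalAdjoint (tensorSum A B)) ∧
    Nonempty (defectPlus (tensorSum A B) ≃ₗᵢ[ℂ] HilbertTensor (defectPlus A) F) ∧
    Nonempty (defectMinus (tensorSum A B) ≃ₗᵢ[ℂ] HilbertTensor (defectMinus A) F) ∧
    ∀ (Jp : defectPlus (tensorSum A B) ≃ₗᵢ[ℂ] HilbertTensor (defectPlus A) F)
      (Jm : defectMinus (tensorSum A B) ≃ₗᵢ[ℂ] HilbertTensor (defectMinus A) F),
      Set.BijOn (extensionOf A B Jp Jm) Set.univ (selfAdjointExtensions (tensorSum A B)) ∧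
      decomposableExtensions A B Jp Jm ⊆ selfAdjointExtensions (tensorSum A B) ∧
      ((selfAdjointExtensions (tensorSum A B)).Nonempty → 1 < Module.rank ℂ F →
        (1 < Module.rank ℂ (defectPlus A) ∨ 1 < Module.rank ℂ (defectMinus A)) →
        decomposableExtensions A B Jp Jm ⊂ selfAdjointExtensions (tensorSum A B)) := by
  have hd := dense_tensorSum_domain hA_dense hB.dense_domain
  have hs := isFormalAdjoint_tensorSum hA_symm (isFormalAdjoint_of_isSelfAdjoint hB)
  refine ⟨⟨hd, hs⟩,
    nonempty_adjointEigenspace_tensorSum_equiv hA_dense hA_symm hB star_I Complex.norm_I,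
    nonempty_adjointEigenspace_tensorSum_equiv hA_dense hA_symm hB star_neg_I
      (by rw [norm_neg, Complex.norm_I]), fun Jp Jm => ?_⟩
  have hbij := bijOn_extensionOf hd hs Jp Jm
  have hsub : decomposableExtensions A B Jp Jm ⊆ selfAdjointExtensions (tensorSum A B) :=
    (Set.image_mono (Set.subset_univ _)).trans hbij.image_eq.subset
  refine ⟨hbij, hsub, fun ⟨S, hS⟩ hF hN => hsub.ssubset_of_ne fun heq => ?_⟩
  -- The given self-adjoint extension serves only to supply some unitary `W₀`.
  obtain ⟨W₀, -, -⟩ := hbij.surjOn hS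
  obtain ⟨W, hW⟩ := exists_not_isDecomposable W₀ hF hN
  have hWS : extensionOf A B Jp Jm W ∈ decomposableExtensions A B Jp Jm :=
    heq ▸ hbij.mapsTo (Set.mem_univ W)
  obtain ⟨W', hW', h⟩ := hWS
  exact hW (hbij.injOn (Set.mem_univ W') (Set.mem_univ W) h ▸ hW')
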